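/- Let $n\ge 2$, let $\Bbbk$ be a field containing a primitive $n$-th root of unity $\zeta$, and let $D(T(n))$ be the Hopf algebra over $\Bbbk$ generated by $g,x,G,X$ with relations $$xg=\zeta gx,\quad GX=\zeta XG,\quad gX=\zeta Xg,\quad xG=\zeta Gx,\quad gG=Gg,\quad g^n=G^n=1,\quad x^n=X^n=0,\quad xX-\zeta Xx=\zeta(gG-1),$$ where $g,G$ are grouplike, $\Delta(x)=1\otimes x+x\otimes g$ and $\Delta(X)=1\otimes X+X\otimes G$ (the Drinfeld double of the $n$-th Taft algebra). An action of a Hopf algebra $H$ on an algebra $A$ is an $H$-module algebra structure on $A$. Paths are composed from left to right, and all indices $i,j$ are taken modulo $n$. **(0) Vertices.** Let $\Bbbk Q_0$ be the path algebra of the quiver with vertices $1,\dots,n$ and no arrows, with trivial paths $e_i$, and let $\gamma^x,\gamma^X\in\Bbbk$. The formulas $$g\cdot e_i=G\cdot e_i=e_{i+1},\quad x\cdot e_i=\gamma^x\zeta^i(e_i-\zeta e_{i+1}),\quad X\cdot e_i=\gamma^X\zeta^{-i}(e_i-\zeta^{-1}e_{i+1})$$ define a (necessarily unique) action of $D(T(n))$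 on $\Bbbk Q_0$ if and only if $n=2$ or $\gamma^x\gamma^X(1-\zeta^{-1})=1$. **(A) Type A.** Let $K_n$ be the quiver with vertices $1,\dots,n$ and one arrow $a^i_j$ from $i$ to $j$ for all $i\ne j$; put $a^i_i:=e_i$. Let $Q$ be a subquiver of $K_n$ containing all vertices and stable under the rotation $i\mapsto i+1$; say that $a^i_j$ *exists* if $i=j$ or the arrow $a^i_j$ is in $Q$. Let $\gamma^x,\gamma^X,\mu^g_{i,j},\mu^G_{i,j},\lambda^x_{i,j},\lambda^X_{i,j}\in\Bbbk$ with $\lambda^x_{i,j}=\lambda^X_{i,j}=0$ whenever $a^i_{j+1}$ does not exist. The formulas, for all existing $a^i_j$ (with terms $0\cdot a^i_{j+1}$ read as $0$), $$g\cdot a^i_j=\mu^g_{i,j}a^{i+1}_{j+1},\qquad x\cdot a^i_j=\gamma^x(\zeta^ja^i_j-\zeta^{i+1}\mu^g_{i,j}a^{i+1}_{j+1})+\lambda^x_{i,j}a^i_{j+1},$$ $$G\cdot a^i_j=\mu^G_{i,j}a^{i+1}_{j+1},\qquad X\cdot a^i_j=\gamma^X(\zeta^{-j}a^i_j-\zeta^{-i-1}\mu^G_{i,j}a^{i+1}_{j+1})+\lambda^X_{i,j}a^i_{j+1}$$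 define an action of $D(T(n))$ on $\Bbbk Q$ if and only if the following hold; the action is then unique and preserves the path length filtration. 1. $\mu^g_{i,i}=\mu^G_{i,i}=1$ and $\lambda^x_{i,i}=\lambda^X_{i,i}=0$ for all $i$. 2. For all $i,j$ such that $a^i_j$ exists: $$\prod_{\ell=0}^{n-1}\mu^g_{i+\ell,j+\ell}=\prod_{\ell=0}^{n-1}\mu^G_{i+\ell,j+\ell}=1,\qquad \mu^G_{i,j}\mu^g_{i+1,j+1}=\mu^g_{i,j}\mu^G_{i+1,j+1},$$ $$\zeta\mu^g_{i,j+1}\lambda^x_{i,j}=\mu^g_{i,j}\lambda^x_{i+1,j+1},\qquad \zeta\mu^G_{i,j+1}\lambda^x_{i,j}=\mu^G_{i,j}\lambda^x_{i+1,j+1},$$ $$\mu^g_{i,j+1}\lambda^X_{i,j}=\zeta\mu^g_{i,j}\lambda^X_{i+1,j+1},\qquad \mu^G_{i,j+1}\lambda^X_{i,j}=\zeta\mu^G_{i,j}\lambda^X_{i+1,j+1},$$ $$\lambda^X_{i,j}\lambda^x_{i,j+1}-\zeta\lambda^x_{i,j}\lambda^X_{i,j+1}=0.$$ 3. If $n\ge3$: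 $\gamma^x\gamma^X(1-\zeta^{-1})=1$. If $n=2$: for each arrow $a^i_j$ of $Q$, $\mu^g_{i,j}=\mu^G_{i,j}$ or $\gamma^x\gamma^X(1-\zeta^{-1})=1$. **(B) Type B.** Let $K_{n,n}$ be the quiver with vertices $1_+,\dots,n_+,1_-,\dots,n_-$ and one arrow $b^i_j$ from $i_+$ to $j_-$ for all $i,j$. Let $Q$ be a subquiver of $K_{n,n}$ containing all vertices and stable under the rotation $i_\pm\mapsto(i+1)_\pm$. Let $\gamma^x_\pm,\gamma^X_\pm,\mu^g_{i,j},\mu^G_{i,j},\lambda^x_{i,j},\lambda^X_{i,j}\in\Bbbk$ with $\lambda^x_{i,j}=\lambda^X_{i,j}=0$ whenever $b^i_{j+1}$ is not in $Q$. The formulas of (0) for $e_{i_+}$ with $\gamma^x_+,\gamma^X_+$ and for $e_{i_-}$ with $\gamma^x_-,\gamma^X_-$, together with, for all arrows $b^i_j$ of $Q$, $$g\cdot b^i_j=\mu^g_{i,j}b^{i+1}_{j+1},\qquad x\cdot b^i_j=\gamma^x_-\zeta^jb^i_j-\gamma^x_+\zeta^{i+1}\mu^g_{i,j}b^{i+1}_{j+1}+\lambda^x_{i,j}b^i_{j+1},$$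 $$G\cdot b^i_j=\mu^G_{i,j}b^{i+1}_{j+1},\qquad X\cdot b^i_j=\gamma^X_-\zeta^{-j}b^i_j-\gamma^X_+\zeta^{-i-1}\mu^G_{i,j}b^{i+1}_{j+1}+\lambda^X_{i,j}b^i_{j+1}$$ define an action of $D(T(n))$ on $\Bbbk Q$ if and only if the following hold; the action is then unique and preserves the path length filtration. 1. For all arrows $b^i_j$ of $Q$, the first three lines of condition (A)2 hold, and $$(\gamma^x_+)^n=(\gamma^x_-)^n+\prod_{\ell=0}^{n-1}\lambda^x_{i,j+\ell},\qquad (\gamma^X_+)^n=(\gamma^X_-)^n+\prod_{\ell=0}^{n-1}\lambda^X_{i,j+\ell}.$$ 2. If $n\ge3$: $\gamma^x_+\gamma^X_+(1-\zeta^{-1})=1=\gamma^x_-\gamma^X_-(1-\zeta^{-1})$, and $\lambda^X_{i,j}\lambda^x_{i,j+1}-\zeta\lambda^x_{i,j}\lambda^X_{i,j+1}=0$ for all arrows $b^i_j$ of $Q$. 3. If $n=2$: for all arrows $b^i_j$ of $Q$, with $c=\mu^G_{i,j}\mu^g_{i+1,j+1}$, $$2\gamma^x_-\gamma^X_--2c\,\gamma^x_+\gamma^X_++\lambda^X_{i,j}\lambda^x_{i,j+1}+\lambda^x_{i,j}\lambda^X_{i,j+1}=1-c.$$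 -/

import Mathlib

open scoped TensorProduct

section QuantumBinomial

/-- Gaussian binomial coefficients evaluated at `q`. -/
def gaussBinom {k : Type*} [CommRing k] (q : k) : ℕ → ℕ → k
  | _, 0 => 1
  | 0, _ + 1 => 0
  | m + 1, j + 1 => gaussBinom q m j + q ^ (j + 1) * gaussBinom q m (j + 1)

theorem gaussBinom_zero_right {k : Type*} [CommRing k] (q : k) (m : ℕ) :
    gaussBinom q m 0 = 1 := by cases m <;> rfl

theorem gaussBinom_of_lt {k : Type*} [CommRing k] (q : k) :
    ∀ m j : ℕ, m < j → gaussBinom q m j = 0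
  | _, 0, h => absurd h (by omega)
  | 0, _ + 1, _ => rfl
  | m + 1, j + 1, h => by
      rw [gaussBinom, gaussBinom_of_lt q m j (by omega),
        gaussBinom_of_lt q m (j + 1) (by omega)]
      ring

theorem gaussBinom_self {k : Type*} [CommRing k] (q : k) (m : ℕ) : gaussBinom q m m = 1 := by
  induction m with
  | zero => rfl
  | succ m ih => rw [gaussBinom, ih, gaussBinom_of_lt q m (m + 1) (by omega)]; ring

theorem gaussBinom_absorb {k : Type*} [CommRing k] (q : k) : ∀ m j : ℕ,
    (1 - q ^ (j + 1)) * gaussBinom q (m + 1) (j + 1) = (1 - q ^ (m + 1)) * gaussBinom q m j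
  | 0, 0 => by simp [gaussBinom]
  | 0, j + 1 => by simp [gaussBinom]
  | m + 1, 0 => by
      have h := gaussBinom_absorb q m 0
      rw [gaussBinom_zero_right] at h ⊢
      rw [gaussBinom, gaussBinom_zero_right]
      linear_combination q * h
  | m + 1, j + 1 => by
      have h1 := gaussBinom_absorb q m (j + 1)
      have h2 := gaussBinom_absorb q m j
      rw [gaussBinom]
      have h3 : gaussBinom q (m + 1) (j + 1)
        = gaussBinom q m j + q ^ (j + 1) * gaussBinom q m (j + 1) := by rw [gaussBinom]
      linear_combination q ^ (j + 2) * h1 + q * h2 + (q ^ (m + 2) - q) * h3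

theorem gaussBinom_eq_zero {k : Type*} [Field k] {q : k} {n : ℕ} (hq : IsPrimitiveRoot q n)
    {j : ℕ} (h0 : 0 < j) (hj : j < n) : gaussBinom q n j = 0 := by
  obtain ⟨m, rfl⟩ : ∃ m, n = m + 1 := ⟨n - 1, by omega⟩
  obtain ⟨i, rfl⟩ : ∃ i, j = i + 1 := ⟨j - 1, by omega⟩
  have h := gaussBinom_absorb q m i
  rw [hq.pow_eq_one, sub_self, zero_mul] at h
  refine (mul_eq_zero.1 h).resolve_left fun h' => ?_
  exact hq.pow_ne_one_of_pos_of_lt (by omega) hj (sub_eq_zero.1 h').symm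

theorem mul_pow_of_qcomm {k A : Type*} [CommRing k] [Ring A] [Algebra k A] {q : k} {a b : A}
    (h : a * b = q • (b * a)) (j : ℕ) : a * b ^ j = q ^ j • (b ^ j * a) := by
  induction j with
  | zero => simp
  | succ j ih =>
    rw [pow_succ, ← mul_assoc, ih, smul_mul_assoc, mul_assoc, h, mul_smul_comm, smul_smul,
      pow_succ, mul_assoc]

theorem add_pow_of_qcomm {k A : Type*} [CommRing k] [Ring A] [Algebra k A] {q : k} {a b : A}
    (h : a * b = q • (b * a)) (m : ℕ) :
    (a + b) ^ m = ∑ j ∈ Finset.range (m + 1), gaussBinom q m j • (b ^ j * a ^ (m - j)) := by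
  induction m with
  | zero => simp [gaussBinom]
  | succ m ih =>
    have e1 : a * ∑ j ∈ Finset.range (m + 1), gaussBinom q m j • (b ^ j * a ^ (m - j))
        = ∑ j ∈ Finset.range (m + 2), (q ^ j * gaussBinom q m j) • (b ^ j * a ^ (m + 1 - j)) := by
      rw [Finset.sum_range_succ _ (m + 1), gaussBinom_of_lt q m (m + 1) (by omega), mul_zero,
        zero_smul, add_zero, Finset.mul_sum]
      refine Finset.sum_congr rfl fun j hj => ?_
      have hj' : j ≤ m := by simpa [Nat.lt_succ_iff] using hj
      rw [mul_smul_comm, ← mul_assoc, mul_pow_of_qcomm h, smul_mul_assoc, smul_smul, mul_assoc,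
        ← pow_succ', mul_comm (q ^ j), Nat.sub_add_comm hj']
    have e2 : b * ∑ j ∈ Finset.range (m + 1), gaussBinom q m j • (b ^ j * a ^ (m - j))
        = ∑ j ∈ Finset.range (m + 1), gaussBinom q m j • (b ^ (j + 1) * a ^ (m - j)) := by
      rw [Finset.mul_sum]
      refine Finset.sum_congr rfl fun j _ => ?_
      rw [mul_smul_comm, ← mul_assoc, ← pow_succ']
    rw [pow_succ', ih, add_mul, e1, e2, Finset.sum_range_succ', Finset.sum_range_succ' _ (m + 1)]
    rw [add_right_comm, ← Finset.sum_add_distrib]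
    simp only [gaussBinom_zero_right, pow_zero, one_mul, gaussBinom, Nat.add_sub_add_right]
    congr 1
    refine Finset.sum_congr rfl fun j _ => ?_
    rw [← add_smul, add_comm]

/-- If `a b = q b a` with `q` a primitive `n`-th root of unity, then `(a + b)^n = a^n + b^n`. -/
theorem add_pow_of_qcomm_primitive {k A : Type*} [Field k] [Ring A] [Algebra k A] {q : k} {a b : A}
    {n : ℕ} [NeZero n] (hq : IsPrimitiveRoot q n) (h : a * b = q • (b * a)) :
    (a + b) ^ n = a ^ n + b ^ n := by
  obtain ⟨m, rfl⟩ : ∃ m, n = m + 1 := ⟨n - 1, by have := NeZero.pos n; omega⟩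
  rw [add_pow_of_qcomm h, Finset.sum_range_succ, Finset.sum_range_succ', Finset.sum_eq_zero]
  · simp [gaussBinom_zero_right, gaussBinom_self]
  · intro j hj
    rw [gaussBinom_eq_zero hq (by omega) (by have := Finset.mem_range.1 hj; omega), zero_smul]

theorem mul_pow_of_qcomm_eq_zero {k A : Type*} [CommRing k] [Ring A] [Algebra k A] {q : k}
    {a b : A} (h : a * b = q • (b * a)) {n : ℕ} (hb : b ^ n = 0) : (b * a) ^ n = 0 := by
  have key : ∀ m : ℕ, ∃ c : k, (b * a) ^ m = c • (b ^ m * a ^ m) := by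
    intro m
    induction m with
    | zero => exact ⟨1, by simp⟩
    | succ m ih =>
      obtain ⟨c, hc⟩ := ih
      refine ⟨q ^ m * c, ?_⟩
      rw [pow_succ', hc, mul_smul_comm, mul_assoc, ← mul_assoc a, mul_pow_of_qcomm h,
        smul_mul_assoc, mul_smul_comm, smul_smul, mul_comm c, mul_assoc, ← pow_succ', ← mul_assoc,
        ← pow_succ']
  obtain ⟨c, hc⟩ := key n
  rw [hc, hb, zero_mul, smul_zero]

end QuantumBinomial

section DrinfeldDouble

/-- The four generators of the Drinfeld double of the Taft algebra. -/
inductive DGen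
  | g
  | x
  | G
  | X

/-- The defining relations of `D(T(n))`, as a property of four elements of an algebra. -/
structure DRelations {k A : Type*} [Field k] [Ring A] [Algebra k A] (n : ℕ) (ζ : k)
    (g x G X : A) : Prop where
  xg : x * g = ζ • (g * x)
  GX : G * X = ζ • (X * G)
  gX : g * X = ζ • (X * g)
  xG : x * G = ζ • (G * x)
  gG : g * G = G * g
  g_pow : g ^ n = 1
  G_pow : G ^ n = 1
  x_pow : x ^ n = 0
  X_pow : X ^ n = 0
  xX : x * X - ζ • (X * x) = ζ • (g * G - 1)

open DGen FreeAlgebra in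
/-- The same relations, imposed on the free algebra on `g, x, G, X`. -/
inductive DRel {k : Type*} [Field k] (n : ℕ) (ζ : k) :
    FreeAlgebra k DGen → FreeAlgebra k DGen → Prop
  | xg : DRel n ζ (ι k x * ι k g) (ζ • (ι k g * ι k x))
  | GX : DRel n ζ (ι k G * ι k X) (ζ • (ι k X * ι k G))
  | gX : DRel n ζ (ι k g * ι k X) (ζ • (ι k X * ι k g))
  | xG : DRel n ζ (ι k x * ι k G) (ζ • (ι k G * ι k x))
  | gG : DRel n ζ (ι k g * ι k G) (ι k G * ι k g)
  | g_pow : DRel n ζ (ι k g ^ n) 1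
  | G_pow : DRel n ζ (ι k G ^ n) 1
  | x_pow : DRel n ζ (ι k x ^ n) 0
  | X_pow : DRel n ζ (ι k X ^ n) 0
  | xX : DRel n ζ (ι k x * ι k X - ζ • (ι k X * ι k x)) (ζ • (ι k g * ι k G - 1))

/-- The Drinfeld double `D(T(n))` of the `n`-th Taft algebra, by generators and relations, for a
primitive `n`-th root of unity `ζ`. -/
def DTaft {k : Type*} [Field k] {n : ℕ} {ζ : k} (_hζ : IsPrimitiveRoot ζ n) : Type _ :=
  RingQuot (DRel n ζ)

namespace DTaft

variable {k : Type*} [Field k] {n : ℕ} {ζ : k} (hζ : IsPrimitiveRoot ζ n)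

noncomputable instance : Ring (DTaft hζ) := inferInstanceAs (Ring (RingQuot (DRel n ζ)))

noncomputable instance : Algebra k (DTaft hζ) := inferInstanceAs (Algebra k (RingQuot (DRel n ζ)))

/-- The image in `D(T(n))` of a generator. -/
noncomputable def of (a : DGen) : DTaft hζ :=
  RingQuot.mkAlgHom k (DRel n ζ) (FreeAlgebra.ι k a)

/-- The generator `g`. -/
noncomputable abbrev g : DTaft hζ := of hζ .g
/-- The generator `x`. -/
noncomputable abbrev x : DTaft hζ := of hζ .x
/-- The generator `G`. -/
noncomputable abbrev G : DTaft hζ := of hζ .G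
/-- The generator `X`. -/
noncomputable abbrev X : DTaft hζ := of hζ .X

theorem relations : DRelations n ζ (g hζ) (x hζ) (G hζ) (X hζ) := by
  have h : ∀ {a b}, DRel n ζ a b → RingQuot.mkAlgHom k (DRel n ζ) a =
      RingQuot.mkAlgHom k (DRel n ζ) b := fun h => RingQuot.mkAlgHom_rel k h
  constructor
  · have := h .xg; rw [map_smul, map_mul, map_mul] at this; exact this
  · have := h .GX; rw [map_smul, map_mul, map_mul] at this; exact this
  · have := h .gX; rw [map_smul, map_mul, map_mul] at this; exact this
  · have := h .xG; rw [map_smul, map_mul, map_mul] at this; exact this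
  · have := h .gG; rw [map_mul, map_mul] at this; exact this
  · have := h .g_pow; rw [map_pow, map_one] at this; exact this
  · have := h .G_pow; rw [map_pow, map_one] at this; exact this
  · have := h .x_pow; rw [map_pow, map_zero] at this; exact this
  · have := h .X_pow; rw [map_pow, map_zero] at this; exact this
  · have := h .xX
    rw [map_sub, map_smul, map_smul, map_sub, map_mul, map_mul, map_mul, map_one] at this
    exact this

/-- The universal property of `D(T(n))`. -/
noncomputable def lift {A : Type*} [Ring A] [Algebra k A] {a b c d : A}
    (h : DRelations n ζ a b c d) : DTaft hζ →ₐ[k] A :=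
  RingQuot.liftAlgHom k ⟨FreeAlgebra.lift k (fun i : DGen => DGen.rec a b c d i), by
    intro u v r
    cases r
    · simpa using h.xg
    · simpa using h.GX
    · simpa using h.gX
    · simpa using h.xG
    · simpa using h.gG
    · simpa using h.g_pow
    · simpa using h.G_pow
    · simpa using h.x_pow
    · simpa using h.X_pow
    · simpa using h.xX⟩

section lift

variable {A : Type*} [Ring A] [Algebra k A] {a b c d : A} (h : DRelations n ζ a b c d)

@[simp] theorem lift_g : lift hζ h (g hζ) = a :=
  (RingQuot.liftAlgHom_mkAlgHom_apply ..).trans (FreeAlgebra.lift_ι_apply ..)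
@[simp] theorem lift_x : lift hζ h (x hζ) = b :=
  (RingQuot.liftAlgHom_mkAlgHom_apply ..).trans (FreeAlgebra.lift_ι_apply ..)
@[simp] theorem lift_G : lift hζ h (G hζ) = c :=
  (RingQuot.liftAlgHom_mkAlgHom_apply ..).trans (FreeAlgebra.lift_ι_apply ..)
@[simp] theorem lift_X : lift hζ h (X hζ) = d :=
  (RingQuot.liftAlgHom_mkAlgHom_apply ..).trans (FreeAlgebra.lift_ι_apply ..)

end lift

@[elab_as_elim]
theorem induction {P : DTaft hζ → Prop} (scalar : ∀ r, P (algebraMap k _ r))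
    (gen : ∀ i, P (of hζ i)) (mul : ∀ a b, P a → P b → P (a * b))
    (add : ∀ a b, P a → P b → P (a + b)) (a : DTaft hζ) : P a := by
  obtain ⟨a, rfl⟩ := RingQuot.mkAlgHom_surjective k (DRel n ζ) a
  induction a using FreeAlgebra.induction with
  | grade0 r => rw [AlgHom.commutes]; exact scalar r
  | grade1 i => exact gen i
  | mul a b ha hb => rw [map_mul]; exact mul _ _ ha hb
  | add a b ha hb => rw [map_add]; exact add _ _ ha hb

theorem algHom_ext {A : Type*} [Semiring A] [Algebra k A] {f f' : DTaft hζ →ₐ[k] A}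
    (hg : f (g hζ) = f' (g hζ)) (hx : f (x hζ) = f' (x hζ)) (hG : f (G hζ) = f' (G hζ))
    (hX : f (X hζ) = f' (X hζ)) : f = f' := by
  refine AlgHom.ext fun a => ?_
  induction a using induction with
  | scalar r => simp
  | gen i => cases i <;> assumption
  | mul a b ha hb => simp [ha, hb]
  | add a b ha hb => simp [ha, hb]

variable [NeZero n]

theorem counit_relations : DRelations n ζ (1 : k) 0 1 0 := by
  constructor <;> simp [NeZero.ne n]

theorem comul_relations : DRelations n ζ (g hζ ⊗ₜ[k] g hζ)
    (1 ⊗ₜ x hζ + x hζ ⊗ₜ g hζ) (G hζ ⊗ₜ G hζ) (1 ⊗ₜ X hζ + X hζ ⊗ₜ G hζ) := by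
  have r := relations hζ
  have hζ0 : ζ ≠ 0 := hζ.ne_zero (NeZero.ne n)
  constructor
  · simp only [add_mul, mul_add, Algebra.TensorProduct.tmul_mul_tmul, one_mul, mul_one, r.xg,
      TensorProduct.tmul_smul, TensorProduct.smul_tmul', smul_add]
  · simp only [add_mul, mul_add, Algebra.TensorProduct.tmul_mul_tmul, one_mul, mul_one, r.GX,
      TensorProduct.tmul_smul, TensorProduct.smul_tmul', smul_add]
  · simp only [add_mul, mul_add, Algebra.TensorProduct.tmul_mul_tmul, one_mul, mul_one, r.gX, r.gG,
      TensorProduct.tmul_smul, TensorProduct.smul_tmul', smul_add]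
  · simp only [add_mul, mul_add, Algebra.TensorProduct.tmul_mul_tmul, one_mul, mul_one, r.xG, r.gG,
      TensorProduct.tmul_smul, TensorProduct.smul_tmul', smul_add]
  · simp only [Algebra.TensorProduct.tmul_mul_tmul, r.gG]
  · rw [Algebra.TensorProduct.tmul_pow, r.g_pow]; rfl
  · rw [Algebra.TensorProduct.tmul_pow, r.G_pow]; rfl
  · rw [add_pow_of_qcomm_primitive hζ, Algebra.TensorProduct.tmul_pow,
      Algebra.TensorProduct.tmul_pow, r.x_pow]
    · simp
    · simp only [Algebra.TensorProduct.tmul_mul_tmul, one_mul, mul_one, r.xg,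
        TensorProduct.tmul_smul]
  · rw [add_pow_of_qcomm_primitive hζ.inv, Algebra.TensorProduct.tmul_pow,
      Algebra.TensorProduct.tmul_pow, r.X_pow]
    · simp
    · simp only [Algebra.TensorProduct.tmul_mul_tmul, one_mul, mul_one, r.GX,
        TensorProduct.tmul_smul, smul_smul, inv_mul_cancel₀ hζ0, one_smul]
  · have e : x hζ * X hζ = ζ • (X hζ * x hζ) + ζ • (g hζ * G hζ - 1) := by
      rw [← r.xX]; abel
    simp only [add_mul, mul_add, Algebra.TensorProduct.tmul_mul_tmul, one_mul, mul_one, r.gX, r.xG,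
      r.gG, e, Algebra.TensorProduct.one_def, TensorProduct.tmul_add, TensorProduct.add_tmul,
      TensorProduct.tmul_sub, TensorProduct.sub_tmul, TensorProduct.tmul_smul,
      TensorProduct.smul_tmul', smul_add, smul_sub]
    abel

/-- `D(T(n))` as a bialgebra: `g`, `G` are grouplike, `x` is `(1, g)`-skew-primitive and `X` is
`(1, G)`-skew-primitive. -/
noncomputable instance : Bialgebra k (DTaft hζ) :=
  Bialgebra.ofAlgHom (lift hζ (comul_relations hζ)) (lift hζ counit_relations)
    (by apply algHom_ext <;>
        simp [TensorProduct.tmul_add, TensorProduct.add_tmul, add_assoc,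
          Algebra.TensorProduct.one_def])
    (by apply algHom_ext <;> simp)
    (by apply algHom_ext <;> simp)

theorem comul_g : Coalgebra.comul (R := k) (g hζ) = g hζ ⊗ₜ g hζ := lift_g ..
theorem comul_x : Coalgebra.comul (R := k) (x hζ) = 1 ⊗ₜ x hζ + x hζ ⊗ₜ g hζ := lift_x ..
theorem comul_G : Coalgebra.comul (R := k) (G hζ) = G hζ ⊗ₜ G hζ := lift_G ..
theorem comul_X : Coalgebra.comul (R := k) (X hζ) = 1 ⊗ₜ X hζ + X hζ ⊗ₜ G hζ := lift_X ..
theorem counit_g : Coalgebra.counit (R := k) (g hζ) = 1 := lift_g ..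
theorem counit_x : Coalgebra.counit (R := k) (x hζ) = 0 := lift_x ..
theorem counit_G : Coalgebra.counit (R := k) (G hζ) = 1 := lift_G ..
theorem counit_X : Coalgebra.counit (R := k) (X hζ) = 0 := lift_X ..

open MulOpposite in
theorem antipode_relations : DRelations n ζ (op (g hζ ^ (n - 1)))
    (op (-(x hζ * g hζ ^ (n - 1)))) (op (G hζ ^ (n - 1))) (op (-(X hζ * G hζ ^ (n - 1)))) := by
  have r := relations hζ
  have hn : n - 1 + 1 = n := Nat.sub_add_cancel (NeZero.pos n)
  have hζ0 : ζ ≠ 0 := hζ.ne_zero (NeZero.ne n)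
  generalize hh : g hζ ^ (n - 1) = h
  generalize hH : G hζ ^ (n - 1) = H
  have gh : g hζ * h = 1 := by rw [← hh, ← pow_succ', hn, r.g_pow]
  have hg : h * g hζ = 1 := by rw [← hh, ← pow_succ, hn, r.g_pow]
  have GH : G hζ * H = 1 := by rw [← hH, ← pow_succ', hn, r.G_pow]
  have HG : H * G hζ = 1 := by rw [← hH, ← pow_succ, hn, r.G_pow]
  -- conjugating a `q`-commutation relation by the inverse
  have conj : ∀ {u u' y : DTaft hζ}, u * u' = 1 → u' * u = 1 → y * u = ζ • (u * y) →
      u' * y = ζ • (y * u') := by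
    intro u u' y h1 h2 h3
    calc u' * y = u' * (y * u) * u' := by rw [mul_assoc, mul_assoc, h1, mul_one]
      _ = ζ • (y * u') := by
        rw [h3, mul_smul_comm, smul_mul_assoc, ← mul_assoc u', h2, one_mul]
  have conj' : ∀ {u u' y : DTaft hζ}, u * u' = 1 → u' * u = 1 → u * y = ζ • (y * u) →
      y * u' = ζ • (u' * y) := by
    intro u u' y h1 h2 h3
    calc y * u' = u' * (u * y) * u' := by rw [← mul_assoc, h2, one_mul]
      _ = ζ • (u' * y) := by
        rw [h3, mul_smul_comm, smul_mul_assoc, mul_assoc, mul_assoc, h1, mul_one]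
  have hx : h * x hζ = ζ • (x hζ * h) := conj gh hg r.xg
  have Hx : H * x hζ = ζ • (x hζ * H) := conj GH HG r.xG
  have Xh : X hζ * h = ζ • (h * X hζ) := conj' gh hg r.gX
  have XH : X hζ * H = ζ • (H * X hζ) := conj' GH HG r.GX
  have Hh : H * h = h * H := by
    rw [← hh, ← hH]; exact ((Commute.pow_pow (r.gG : Commute _ _) _ _).eq).symm
  have hX' : h * X hζ = ζ⁻¹ • (X hζ * h) := by rw [Xh, inv_smul_smul₀ hζ0]
  have HX' : H * X hζ = ζ⁻¹ • (X hζ * H) := by rw [XH, inv_smul_smul₀ hζ0]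
  constructor
  · rw [← op_mul, ← op_mul, ← op_smul, mul_neg, neg_mul, ← mul_assoc, hx, smul_mul_assoc, smul_neg]
  · rw [← op_mul, ← op_mul, ← op_smul, mul_neg, neg_mul, ← mul_assoc, HX', smul_mul_assoc,
      smul_neg, smul_smul, mul_inv_cancel₀ hζ0, one_smul]
  · rw [← op_mul, ← op_mul, ← op_smul, mul_neg, neg_mul, ← mul_assoc, hX', smul_mul_assoc,
      smul_neg, smul_smul, mul_inv_cancel₀ hζ0, one_smul, mul_assoc, mul_assoc, Hh]
  · rw [← op_mul, ← op_mul, ← op_smul, mul_neg, neg_mul, ← mul_assoc, Hx, smul_mul_assoc,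
      smul_neg, mul_assoc, mul_assoc, Hh]
  · rw [← op_mul, ← op_mul, Hh]
  · rw [← op_pow, ← hh, ← pow_mul, mul_comm, pow_mul, r.g_pow, one_pow, op_one]
  · rw [← op_pow, ← hH, ← pow_mul, mul_comm, pow_mul, r.G_pow, one_pow, op_one]
  · rw [← op_pow, neg_pow, mul_pow_of_qcomm_eq_zero hx r.x_pow, mul_zero, op_zero]
  · rw [← op_pow, neg_pow, mul_pow_of_qcomm_eq_zero HX' r.X_pow, mul_zero, op_zero]
  · have e : x hζ * X hζ = ζ • (X hζ * x hζ) + ζ • (g hζ * G hζ - 1) := by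
      rw [← r.xX]; abel
    have e1 : X hζ * H * (x hζ * h) = ζ • (X hζ * x hζ * (H * h)) := by
      rw [mul_assoc, ← mul_assoc H, Hx, smul_mul_assoc, mul_smul_comm, mul_assoc, mul_assoc]
    have e2 : x hζ * h * (X hζ * H) = ζ⁻¹ • (x hζ * X hζ * (H * h)) := by
      rw [mul_assoc, ← mul_assoc h, hX', smul_mul_assoc, mul_smul_comm, mul_assoc, mul_assoc, Hh]
    have e3 : g hζ * G hζ * (H * h) = 1 := by
      rw [mul_assoc, ← mul_assoc (G hζ), GH, one_mul, gh]
    rw [← op_mul, ← op_mul, ← op_mul, ← op_one, ← op_smul, ← op_sub, ← op_sub, ← op_smul,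
      neg_mul_neg, neg_mul_neg, e1, e2, smul_smul, mul_inv_cancel₀ hζ0, one_smul, e,
      add_mul, smul_mul_assoc, smul_mul_assoc, sub_mul, e3, one_mul, sub_add_cancel_left,
      ← smul_neg, neg_sub]

/-- The antipode, as an algebra map to the opposite algebra. -/
noncomputable def antipodeHom : DTaft hζ →ₐ[k] (DTaft hζ)ᵐᵒᵖ := lift hζ (antipode_relations hζ)

/-- The antipode as a linear map. -/
noncomputable def antipodeLin : DTaft hζ →ₗ[k] DTaft hζ :=
  (MulOpposite.opLinearEquiv k).symm.toLinearMap ∘ₗ (antipodeHom hζ).toLinearMap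

theorem antipodeLin_mul (a b : DTaft hζ) :
    antipodeLin hζ (a * b) = antipodeLin hζ b * antipodeLin hζ a := by
  simp [antipodeLin]

theorem antipodeLin_algebraMap (r : k) :
    antipodeLin hζ (algebraMap k _ r) = algebraMap k _ r := by
  simp [antipodeLin]

theorem antipodeLin_one : antipodeLin hζ 1 = 1 := by simp [antipodeLin]
theorem antipodeLin_g : antipodeLin hζ (g hζ) = g hζ ^ (n - 1) := by
  simp [antipodeLin, antipodeHom]
theorem antipodeLin_x : antipodeLin hζ (x hζ) = -(x hζ * g hζ ^ (n - 1)) := by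
  simp [antipodeLin, antipodeHom]
theorem antipodeLin_G : antipodeLin hζ (G hζ) = G hζ ^ (n - 1) := by
  simp [antipodeLin, antipodeHom]
theorem antipodeLin_X : antipodeLin hζ (X hζ) = -(X hζ * G hζ ^ (n - 1)) := by
  simp [antipodeLin, antipodeHom]

theorem rTensor_mul (t : DTaft hζ ⊗[k] DTaft hζ) (a b : DTaft hζ) :
    LinearMap.mul' k _ ((antipodeLin hζ).rTensor _ (t * (a ⊗ₜ b))) =
      antipodeLin hζ a * LinearMap.mul' k _ ((antipodeLin hζ).rTensor _ t) * b := by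
  induction t using TensorProduct.induction_on with
  | zero => simp
  | tmul u v => simp [antipodeLin_mul, mul_assoc]
  | add s t hs ht => simp only [add_mul, map_add, mul_add, hs, ht]

theorem lTensor_mul (t : DTaft hζ ⊗[k] DTaft hζ) (a b : DTaft hζ) :
    LinearMap.mul' k _ ((antipodeLin hζ).lTensor _ ((a ⊗ₜ b) * t)) =
      a * LinearMap.mul' k _ ((antipodeLin hζ).lTensor _ t) * antipodeLin hζ b := by
  induction t using TensorProduct.induction_on with
  | zero => simp
  | tmul u v => simp [antipodeLin_mul, mul_assoc]
  | add s t hs ht => simp only [add_mul, map_add, mul_add, hs, ht]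

/-- `D(T(n))` is a Hopf algebra. -/
noncomputable instance : HopfAlgebra k (DTaft hζ) where
  antipode := antipodeLin hζ
  mul_antipode_rTensor_comul := by
    have r := relations hζ
    have hn : n - 1 + 1 = n := Nat.sub_add_cancel (NeZero.pos n)
    refine LinearMap.ext fun a => ?_
    simp only [LinearMap.comp_apply, Algebra.linearMap_apply]
    induction a using induction with
    | scalar s =>
      rw [Bialgebra.comul_algebraMap, Bialgebra.counit_algebraMap]
      simp [Algebra.TensorProduct.algebraMap_apply, antipodeLin_algebraMap]
    | gen i =>
      cases i
      · rw [comul_g, counit_g]; simp [antipodeLin_g, ← pow_succ, hn, r.g_pow]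
      · rw [comul_x, counit_x]
        simp [antipodeLin_x, antipodeLin_one, mul_assoc, ← pow_succ, hn, r.g_pow]
      · rw [comul_G, counit_G]; simp [antipodeLin_G, ← pow_succ, hn, r.G_pow]
      · rw [comul_X, counit_X]
        simp [antipodeLin_X, antipodeLin_one, mul_assoc, ← pow_succ, hn, r.G_pow]
    | mul a b ha hb =>
      rw [Bialgebra.comul_mul, Bialgebra.counit_mul, map_mul (algebraMap k (DTaft hζ)), ← hb]
      generalize Coalgebra.comul (R := k) b = t
      induction t using TensorProduct.induction_on with
      | zero => simp
      | tmul u v =>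
        rw [rTensor_mul, ha, ← Algebra.commutes, mul_assoc]; simp
      | add s t hs ht => simp only [map_add, mul_add, hs, ht]
    | add a b ha hb => simp only [map_add, ha, hb]
  mul_antipode_lTensor_comul := by
    have r := relations hζ
    have hn : n - 1 + 1 = n := Nat.sub_add_cancel (NeZero.pos n)
    refine LinearMap.ext fun a => ?_
    simp only [LinearMap.comp_apply, Algebra.linearMap_apply]
    induction a using induction with
    | scalar s =>
      rw [Bialgebra.comul_algebraMap, Bialgebra.counit_algebraMap]
      simp [Algebra.TensorProduct.algebraMap_apply, antipodeLin_one]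
    | gen i =>
      cases i
      · rw [comul_g, counit_g]; simp [antipodeLin_g, ← pow_succ', hn, r.g_pow]
      · rw [comul_x, counit_x]
        simp [antipodeLin_x, antipodeLin_g]
      · rw [comul_G, counit_G]; simp [antipodeLin_G, ← pow_succ', hn, r.G_pow]
      · rw [comul_X, counit_X]
        simp [antipodeLin_X, antipodeLin_G]
    | mul a b ha hb =>
      rw [Bialgebra.comul_mul, Bialgebra.counit_mul, map_mul (algebraMap k (DTaft hζ)), ← ha]
      generalize Coalgebra.comul (R := k) a = t
      induction t using TensorProduct.induction_on with
      | zero => simp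
      | tmul u v =>
        rw [lTensor_mul, hb, mul_assoc, Algebra.commutes, ← mul_assoc]; simp
      | add s t hs ht => simp only [map_add, add_mul, hs, ht]
    | add a b ha hb => simp only [map_add, ha, hb]

end DTaft

end DrinfeldDouble

section HopfActions

/-- An action of a Hopf algebra `H` on an algebra `A`: a left `H`-module structure on `A` with
`h · (p q) = ∑ (h₁ · p) (h₂ · q)` and `h · 1 = ε(h) 1`. -/
@[ext]
structure HopfAction (k H A : Type*) [Field k] [Ring H] [HopfAlgebra k H] [Ring A]
    [Algebra k A] where
  act : H →ₐ[k] Module.End k A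
  act_mul : ∀ (h : H) (p q : A), act h (p * q) =
    LinearMap.mul' k A (TensorProduct.map (act.toLinearMap.flip p) (act.toLinearMap.flip q)
      (Coalgebra.comul (R := k) h))
  act_one : ∀ h : H, act h 1 = Coalgebra.counit (R := k) h • (1 : A)

end HopfActions

section PathAlgebras

open FreeAlgebra in
/-- The defining relations of the path algebra; the generators are the trivial paths `e_i` and the
arrows, and paths are composed from left to right. -/
inductive PathRel (k V : Type*) [Field k] [Fintype V] [Quiver V] :
    FreeAlgebra k (V ⊕ Quiver.Total V) → FreeAlgebra k (V ⊕ Quiver.Total V) → Prop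
  | sum_vertex : PathRel k V (∑ i, ι k (.inl i)) 1
  | idem (i : V) : PathRel k V (ι k (.inl i) * ι k (.inl i)) (ι k (.inl i))
  | orth (i j : V) (h : i ≠ j) : PathRel k V (ι k (.inl i) * ι k (.inl j)) 0
  | source (a : Quiver.Total V) : PathRel k V (ι k (.inl a.left) * ι k (.inr a)) (ι k (.inr a))
  | target (a : Quiver.Total V) : PathRel k V (ι k (.inr a) * ι k (.inl a.right)) (ι k (.inr a))

/-- The path algebra of a quiver with finitely many vertices. -/
def PathAlgebra (k V : Type*) [Field k] [Fintype V] [Quiver V] : Type _ :=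
  RingQuot (PathRel k V)

namespace PathAlgebra

variable (k : Type*) {V : Type*} [Field k] [Fintype V] [Quiver V]

noncomputable instance : Ring (PathAlgebra k V) := inferInstanceAs (Ring (RingQuot (PathRel k V)))

noncomputable instance : Algebra k (PathAlgebra k V) :=
  inferInstanceAs (Algebra k (RingQuot (PathRel k V)))

/-- The trivial path at a vertex. -/
noncomputable def vertex (i : V) : PathAlgebra k V :=
  RingQuot.mkAlgHom k (PathRel k V) (FreeAlgebra.ι k (.inl i))

/-- An arrow, as an element of the path algebra. -/
noncomputable def arrow {i j : V} (a : i ⟶ j) : PathAlgebra k V :=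
  RingQuot.mkAlgHom k (PathRel k V) (FreeAlgebra.ι k (.inr ⟨i, j, a⟩))

/-- A path, as an element of the path algebra. -/
noncomputable def ofPath {i : V} : {j : V} → Quiver.Path i j → PathAlgebra k V
  | _, .nil => vertex k i
  | _, .cons p a => ofPath p * arrow k a

/-- The path length filtration: the span of the paths of length at most `m`. -/
noncomputable def filtration (V : Type*) [Fintype V] [Quiver V] (m : ℕ) :
    Submodule k (PathAlgebra k V) :=
  Submodule.span k {z | ∃ (i j : V) (p : Quiver.Path i j), p.length ≤ m ∧ z = ofPath k p}

/-- A Hopf action that preserves the path length filtration. -/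
def Filtered {k H V : Type*} [Field k] [Fintype V] [Quiver V] [Ring H] [HopfAlgebra k H]
    (φ : HopfAction k H (PathAlgebra k V)) : Prop :=
  ∀ (h : H) (m : ℕ), ∀ z ∈ filtration k V m, φ.act h z ∈ filtration k V m

end PathAlgebra

/-- The vertex set of the complete quiver `K_n`; the label `n` is the residue class `0`. -/
def CompleteQuiver (n : ℕ) : Type := ZMod n

namespace CompleteQuiver

variable {n : ℕ}

/-- One arrow from `i` to `j` for every ordered pair of distinct vertices. -/
instance : Quiver (CompleteQuiver n) := ⟨fun i j => PLift (i ≠ j)⟩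

instance [NeZero n] (Q : WideSubquiver (CompleteQuiver n)) : Fintype Q :=
  inferInstanceAs (Fintype (ZMod n))

/-- The arrow `a^i_j` exists in `Q`. -/
def HasArrow (Q : WideSubquiver (CompleteQuiver n)) (i j : ZMod n) : Prop :=
  ∃ a : (show CompleteQuiver n from i) ⟶ (show CompleteQuiver n from j), a ∈ Q i j

/-- `Q` is stable under the rotation `i ↦ i + 1` of `K_n`. -/
def Stable (Q : WideSubquiver (CompleteQuiver n)) : Prop :=
  ∀ i j : ZMod n, HasArrow Q i j ↔ HasArrow Q (i + 1) (j + 1)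

/-- `a^i_j` is a path of `Q` of length at most one: a trivial path (`i = j`) or an arrow. -/
def HasPath (Q : WideSubquiver (CompleteQuiver n)) (i j : ZMod n) : Prop :=
  i = j ∨ HasArrow Q i j

open Classical in
/-- The element `a^i_j` of the path algebra of `Q`: the trivial path `e_i` if `i = j`, the arrow
from `i` to `j` if it lies in `Q`, and `0` otherwise. -/
noncomputable def a (k : Type*) [Field k] [NeZero n] (Q : WideSubquiver (CompleteQuiver n))
    (i j : ZMod n) : PathAlgebra k Q :=
  if i = j then PathAlgebra.vertex k (V := Q) i
  else if h : HasArrow Q i j then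
    PathAlgebra.arrow k (V := Q) (i := i) (j := j) ⟨h.choose, h.choose_spec⟩
  else 0

end CompleteQuiver

/-- The vertex set of the complete bipartite quiver `K_{n,n}`: `top i` is `i_+`, `bot j` is
`j_-`. -/
inductive BipartiteQuiver (n : ℕ) : Type
  | top (i : ZMod n)
  | bot (j : ZMod n)

namespace BipartiteQuiver

variable {n : ℕ}

/-- One arrow from every `i_+` to every `j_-`. -/
inductive Arrow : BipartiteQuiver n → BipartiteQuiver n → Type
  | b (i j : ZMod n) : Arrow (top i) (bot j)

instance : Quiver (BipartiteQuiver n) := ⟨Arrow⟩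

/-- The vertices of `K_{n,n}` are two copies of `ZMod n`. -/
def equivSum (n : ℕ) : ZMod n ⊕ ZMod n ≃ BipartiteQuiver n where
  toFun := Sum.elim top bot
  invFun
    | top i => .inl i
    | bot j => .inr j
  left_inv := by rintro (_ | _) <;> rfl
  right_inv := by rintro (_ | _) <;> rfl

noncomputable instance [NeZero n] (Q : WideSubquiver (BipartiteQuiver n)) : Fintype Q :=
  Fintype.ofEquiv (ZMod n ⊕ ZMod n) (equivSum n)

/-- The arrow `b^i_j` exists in `Q`. -/
def HasArrow (Q : WideSubquiver (BipartiteQuiver n)) (i j : ZMod n) : Prop :=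
  Arrow.b i j ∈ Q (top i) (bot j)

/-- `Q` is stable under the rotation `i_± ↦ (i + 1)_±` of `K_{n,n}`. -/
def Stable (Q : WideSubquiver (BipartiteQuiver n)) : Prop :=
  ∀ i j : ZMod n, HasArrow Q i j ↔ HasArrow Q (i + 1) (j + 1)

/-- The trivial path at `i_+`. -/
noncomputable def ePlus (k : Type*) [Field k] [NeZero n] (Q : WideSubquiver (BipartiteQuiver n))
    (i : ZMod n) : PathAlgebra k Q :=
  PathAlgebra.vertex k (V := Q) (top i)

/-- The trivial path at `j_-`. -/
noncomputable def eMinus (k : Type*) [Field k] [NeZero n] (Q : WideSubquiver (BipartiteQuiver n))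
    (j : ZMod n) : PathAlgebra k Q :=
  PathAlgebra.vertex k (V := Q) (bot j)

open Classical in
/-- The element `b^i_j` of the path algebra of `Q`, read as `0` if the arrow is not in `Q`. -/
noncomputable def b (k : Type*) [Field k] [NeZero n] (Q : WideSubquiver (BipartiteQuiver n))
    (i j : ZMod n) : PathAlgebra k Q :=
  if h : HasArrow Q i j then
    PathAlgebra.arrow k (V := Q) (i := top i) (j := bot j) ⟨Arrow.b i j, h⟩
  else 0

end BipartiteQuiver

end PathAlgebras

section Actions

/-- `ζ ^ i` for an exponent `i` modulo `n`, where `ζ ^ n = 1`. -/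
def rootPow {k : Type*} [Field k] {n : ℕ} (ζ : k) (i : ZMod n) : k := ζ ^ i.val

/-- The scalars `μ^g, μ^G, λ^x, λ^X` of an action, indexed by the labels `i, j` of `a^i_j` or
`b^i_j`; only the values at arrows (and trivial paths) of the quiver matter. -/
structure ArrowScalars (k : Type*) (n : ℕ) where
  μg : ZMod n → ZMod n → k
  μG : ZMod n → ZMod n → k
  lx : ZMod n → ZMod n → k
  lX : ZMod n → ZMod n → k

/-- The quiver with vertices `1, …, n` and no arrows. -/
abbrev vertexQuiver (n : ℕ) : WideSubquiver (CompleteQuiver n) := ⊥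

variable {k : Type*} [Field k] {n : ℕ} [NeZero n] {ζ : k} {hζ : IsPrimitiveRoot ζ n}

open DTaft CompleteQuiver in
/-- The action `φ` on `𝕜Q₀` is the one with parameters `γ^x, γ^X`. -/
def IsVertexAction (γx γX : k)
    (φ : HopfAction k (DTaft hζ) (PathAlgebra k (vertexQuiver n))) : Prop :=
  let e : ZMod n → PathAlgebra k (vertexQuiver n) :=
    fun i => PathAlgebra.vertex k (V := vertexQuiver n) i
  ∀ i : ZMod n,
    φ.act (g hζ) (e i) = e (i + 1) ∧
    φ.act (G hζ) (e i) = e (i + 1) ∧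
    φ.act (x hζ) (e i) = (γx * rootPow ζ i) • (e i - ζ • e (i + 1)) ∧
    φ.act (X hζ) (e i) = (γX * (rootPow ζ i)⁻¹) • (e i - ζ⁻¹ • e (i + 1))

open DTaft CompleteQuiver in
/-- The action `φ` on the path algebra of a subquiver of `K_n` is given by the Taft-type formulas
with parameters `γ^x, γ^X` and `s`, on all trivial paths and arrows `a^i_j` of `Q`. -/
def IsTypeAAction (Q : WideSubquiver (CompleteQuiver n)) (γx γX : k) (s : ArrowScalars k n)
    (φ : HopfAction k (DTaft hζ) (PathAlgebra k Q)) : Prop :=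
  ∀ i j : ZMod n, HasPath Q i j →
    φ.act (g hζ) (a k Q i j) = s.μg i j • a k Q (i + 1) (j + 1) ∧
    φ.act (G hζ) (a k Q i j) = s.μG i j • a k Q (i + 1) (j + 1) ∧
    φ.act (x hζ) (a k Q i j) =
      γx • (rootPow ζ j • a k Q i j - (rootPow ζ (i + 1) * s.μg i j) • a k Q (i + 1) (j + 1))
        + s.lx i j • a k Q i (j + 1) ∧
    φ.act (X hζ) (a k Q i j) =
      γX • ((rootPow ζ j)⁻¹ • a k Q i j - ((rootPow ζ (i + 1))⁻¹ * s.μG i j) • a k Q (i + 1) (j + 1))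
        + s.lX i j • a k Q i (j + 1)

open DTaft BipartiteQuiver in
/-- The action `φ` on the path algebra of a subquiver of `K_{n,n}` is given by the Taft-type
formulas with parameters `γ^x_±, γ^X_±` and `s`, on the trivial paths and on the arrows `b^i_j`
of `Q`. -/
def IsTypeBAction (Q : WideSubquiver (BipartiteQuiver n)) (γxp γxm γXp γXm : k)
    (s : ArrowScalars k n) (φ : HopfAction k (DTaft hζ) (PathAlgebra k Q)) : Prop :=
  (∀ i : ZMod n,
    φ.act (g hζ) (ePlus k Q i) = ePlus k Q (i + 1) ∧
    φ.act (G hζ) (ePlus k Q i) = ePlus k Q (i + 1) ∧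
    φ.act (x hζ) (ePlus k Q i) = (γxp * rootPow ζ i) • (ePlus k Q i - ζ • ePlus k Q (i + 1)) ∧
    φ.act (X hζ) (ePlus k Q i) =
      (γXp * (rootPow ζ i)⁻¹) • (ePlus k Q i - ζ⁻¹ • ePlus k Q (i + 1))) ∧
  (∀ j : ZMod n,
    φ.act (g hζ) (eMinus k Q j) = eMinus k Q (j + 1) ∧
    φ.act (G hζ) (eMinus k Q j) = eMinus k Q (j + 1) ∧
    φ.act (x hζ) (eMinus k Q j) = (γxm * rootPow ζ j) • (eMinus k Q j - ζ • eMinus k Q (j + 1)) ∧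
    φ.act (X hζ) (eMinus k Q j) =
      (γXm * (rootPow ζ j)⁻¹) • (eMinus k Q j - ζ⁻¹ • eMinus k Q (j + 1))) ∧
  ∀ i j : ZMod n, HasArrow Q i j →
    φ.act (g hζ) (b k Q i j) = s.μg i j • b k Q (i + 1) (j + 1) ∧
    φ.act (G hζ) (b k Q i j) = s.μG i j • b k Q (i + 1) (j + 1) ∧
    φ.act (x hζ) (b k Q i j) =
      (γxm * rootPow ζ j) • b k Q i j - (γxp * rootPow ζ (i + 1) * s.μg i j) • b k Q (i + 1) (j + 1)
        + s.lx i j • b k Q i (j + 1) ∧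
    φ.act (X hζ) (b k Q i j) =
      (γXm * (rootPow ζ j)⁻¹) • b k Q i j
        - (γXp * (rootPow ζ (i + 1))⁻¹ * s.μG i j) • b k Q (i + 1) (j + 1)
        + s.lX i j • b k Q i (j + 1)

/-- The conditions on `μ^g, μ^G, λ^x, λ^X` at one index `(i, j)` that both types share. -/
structure ArrowScalars.CompatibleAt (s : ArrowScalars k n) (ζ : k) (i j : ZMod n) : Prop where
  prod_μg : ∏ l ∈ Finset.range n, s.μg (i + l) (j + l) = 1
  prod_μG : ∏ l ∈ Finset.range n, s.μG (i + l) (j + l) = 1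
  comm : s.μG i j * s.μg (i + 1) (j + 1) = s.μg i j * s.μG (i + 1) (j + 1)
  xg : ζ * s.μg i (j + 1) * s.lx i j = s.μg i j * s.lx (i + 1) (j + 1)
  GX : s.μG i (j + 1) * s.lX i j = ζ * s.μG i j * s.lX (i + 1) (j + 1)
  gX : s.μg i (j + 1) * s.lX i j = ζ * s.μg i j * s.lX (i + 1) (j + 1)
  xG : ζ * s.μG i (j + 1) * s.lx i j = s.μG i j * s.lx (i + 1) (j + 1)

open CompleteQuiver in
/-- The restrictions on the parameters of a Type A action. -/
structure TypeARestrictions (Q : WideSubquiver (CompleteQuiver n)) (ζ γx γX : k)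
    (s : ArrowScalars k n) : Prop where
  μ_diag : ∀ i, s.μg i i = 1 ∧ s.μG i i = 1
  compatible : ∀ i j, HasPath Q i j → s.CompatibleAt ζ i j
  l_comm : ∀ i j, HasPath Q i j → s.lX i j * s.lx i (j + 1) - ζ * s.lx i j * s.lX i (j + 1) = 0
  l_eq_zero : ∀ i j, i = j ∨ ¬ HasPath Q i (j + 1) → s.lx i j = 0 ∧ s.lX i j = 0
  γ_ge_three : 3 ≤ n → γx * γX * (1 - ζ⁻¹) = 1
  γ_two : n = 2 → ∀ i j, HasArrow Q i j → s.μg i j = s.μG i j ∨ γx * γX * (1 - ζ⁻¹) = 1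

open BipartiteQuiver in
/-- The restrictions on the parameters of a Type B action. -/
structure TypeBRestrictions (Q : WideSubquiver (BipartiteQuiver n)) (ζ γxp γxm γXp γXm : k)
    (s : ArrowScalars k n) : Prop where
  compatible : ∀ i j, HasArrow Q i j → s.CompatibleAt ζ i j
  l_eq_zero : ∀ i j, ¬ HasArrow Q i (j + 1) → s.lx i j = 0 ∧ s.lX i j = 0
  x_pow : ∀ i j, HasArrow Q i j →
    γxp ^ n = γxm ^ n + ∏ l ∈ Finset.range n, s.lx i (j + l)
  X_pow : ∀ i j, HasArrow Q i j →
    γXp ^ n = γXm ^ n + ∏ l ∈ Finset.range n, s.lX i (j + l)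
  γ_ge_three : 3 ≤ n → γxp * γXp * (1 - ζ⁻¹) = 1 ∧ γxm * γXm * (1 - ζ⁻¹) = 1
  l_comm : 3 ≤ n → ∀ i j, HasArrow Q i j →
    s.lX i j * s.lx i (j + 1) - ζ * s.lx i j * s.lX i (j + 1) = 0
  γ_two : n = 2 → ∀ i j, HasArrow Q i j →
    2 * (γxm * γXm) - 2 * (s.μG i j * s.μg (i + 1) (j + 1)) * (γxp * γXp)
      + s.lX i j * s.lx i (j + 1) + s.lx i j * s.lX i (j + 1)
      = 1 - s.μG i j * s.μg (i + 1) (j + 1)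

end Actions

/-! ### Actions of `D(T(n))` as operators satisfying the relations -/

section DTaftActions

/-! An action of `D(T(n))` on `A` amounts to algebra endomorphisms `g`, `G` and skew derivations
`x`, `X` (twisted by `g` and `G` respectively) that satisfy the defining relations as operators. The
relations need checking only on algebra generators of `A`: each one passes from two factors to their
product. For `x ^ n = 0` this is the q-binomial theorem, which makes `x ^ n` obey a Leibniz rule
twisted by `g ^ n` (`IsSkewDerivation.pow`, `DRelationsAt.of_adjoin_eq_top`).

On a path algebra there is no obstruction to building the operators. The universal property gives
`g` and `G`. The skew derivation `x` is an inner one, `p ↦ p W - W g(p)` with `W` a weighted sum of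
trivial paths, plus one that kills the trivial paths and carries the `λ` terms. So everything
reduces to when the ten relations hold on trivial paths and arrows (`orbit_relations_iff`).

Trivial paths and arrows form families `a i j` on which `x` is a sum of three terms: a diagonal one,
a rotation `(i, j) ↦ (i + 1, j + 1)` and a shift `(i, j) ↦ (i, j + 1)`. The q-commutation relations
leave only the `λ` terms, and these give the linear conditions linking `λ` and `μ`. Once they hold,
the three terms pairwise `ζ`-commute, so `x ^ n` is the sum of their `n`-th powers. This is the
scalar `γt ^ n - γs ^ n + ∏ λ` (`IsTaftOperator.pow_apply`). The relation between `x` and `X`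
reduces to a combination of `a i j`, `a (i + 2) (j + 2)` and `a i (j + 2)`
(`IsTaftOperator.sub_apply`). For `n ≥ 3` the three positions are distinct and each coefficient must
vanish; for `n = 2` they coincide and only the sum must vanish.

Coefficients can be compared because a representation of the path algebra by matrix units separates
the `a i j`. In Type A the trivial paths are the diagonal of a single family; in Type B the two
vertex orbits and the arrows are three families. -/

/-- The defining relations of `D(T(n))` for four linear operators, evaluated at a vector. -/
structure DRelationsAt {k A : Type*} [Field k] [AddCommGroup A] [Module k A] (n : ℕ) (ζ : k)
    (g x G X : Module.End k A) (v : A) : Prop where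
  xg : x (g v) = ζ • g (x v)
  GX : G (X v) = ζ • X (G v)
  gX : g (X v) = ζ • X (g v)
  xG : x (G v) = ζ • G (x v)
  gG : g (G v) = G (g v)
  g_pow : (g ^ n) v = v
  G_pow : (G ^ n) v = v
  x_pow : (x ^ n) v = 0
  X_pow : (X ^ n) v = 0
  xX : x (X v) - ζ • X (x v) = ζ • (g (G v) - v)

theorem dRelations_iff_forall_at {k A : Type*} [Field k] [AddCommGroup A] [Module k A] {n : ℕ}
    {ζ : k} {g x G X : Module.End k A} :
    DRelations n ζ g x G X ↔ ∀ v, DRelationsAt n ζ g x G X v := by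
  constructor
  · intro h v
    constructor
    · exact DFunLike.congr_fun h.xg v
    · exact DFunLike.congr_fun h.GX v
    · exact DFunLike.congr_fun h.gX v
    · exact DFunLike.congr_fun h.xG v
    · exact DFunLike.congr_fun h.gG v
    · exact DFunLike.congr_fun h.g_pow v
    · exact DFunLike.congr_fun h.G_pow v
    · exact DFunLike.congr_fun h.x_pow v
    · exact DFunLike.congr_fun h.X_pow v
    · exact DFunLike.congr_fun h.xX v
  · intro h
    constructor <;> ext v
    · exact (h v).xg
    · exact (h v).GX
    · exact (h v).gX
    · exact (h v).xG
    · exact (h v).gG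
    · exact (h v).g_pow
    · exact (h v).G_pow
    · exact (h v).x_pow
    · exact (h v).X_pow
    · exact (h v).xX

theorem DRelations.map {k A B : Type*} [Field k] [Ring A] [Algebra k A] [Ring B] [Algebra k B]
    {n : ℕ} {ζ : k} {g x G X : A} (h : DRelations n ζ g x G X) (f : A →ₐ[k] B) :
    DRelations n ζ (f g) (f x) (f G) (f X) := by
  constructor
  · simpa using congr_arg f h.xg
  · simpa using congr_arg f h.GX
  · simpa using congr_arg f h.gX
  · simpa using congr_arg f h.xG
  · simpa using congr_arg f h.gG
  · simpa using congr_arg f h.g_pow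
  · simpa using congr_arg f h.G_pow
  · simpa using congr_arg f h.x_pow
  · simpa using congr_arg f h.X_pow
  · simpa using congr_arg f h.xX

/-! ### Skew derivations and the passage from generators to the whole algebra -/

section SkewDerivation

variable {k A : Type*} [Field k] [Ring A] [Algebra k A]

/-- `D (p q) = p D(q) + D(p) σ(q)`. -/
def IsSkewDerivation (σ : A → A) (D : Module.End k A) : Prop :=
  ∀ p q, D (p * q) = p * D q + D p * σ q

theorem IsSkewDerivation.map_one {σ : A →ₐ[k] A} {D : Module.End k A}
    (h : IsSkewDerivation σ D) : D 1 = 0 := by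
  have := h 1 1
  simpa using this

/-- A skew derivation that `ζ`-commutes with its endomorphism has an `n`-th power that is again a
skew derivation. -/
theorem IsSkewDerivation.pow {n : ℕ} [NeZero n] {q : k} (hq : IsPrimitiveRoot q n)
    {σ : A →ₐ[k] A} {D : Module.End k A} (h : IsSkewDerivation σ D)
    (hD : ∀ v, D (σ v) = q • σ (D v)) (v w : A) :
    (D ^ n) (v * w) = v * (D ^ n) w + (D ^ n) v * (σ.toLinearMap ^ n) w := by
  -- On `A ⊗ A` the Leibniz rule says that multiplication intertwines `U + W` with `D`. Since `U W =
  -- q W U`, the n-th power of `U + W` has no mixed terms.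
  let U : Module.End k (A ⊗[k] A) := TensorProduct.map LinearMap.id D
  let W : Module.End k (A ⊗[k] A) := TensorProduct.map D σ.toLinearMap
  have hUW : U * W = q • (W * U) := by
    ext a b
    simp [U, W, hD, TensorProduct.tmul_smul]
  have hcomm : ∀ (m : ℕ) (t : A ⊗[k] A),
      (D ^ m) (LinearMap.mul' k A t) = LinearMap.mul' k A (((U + W) ^ m) t) := by
    intro m
    induction m with
    | zero => intro t; simp
    | succ m ih =>
      intro t
      rw [pow_succ, Module.End.mul_apply, pow_succ, Module.End.mul_apply, ← ih]
      congr 1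
      induction t using TensorProduct.induction_on with
      | zero => simp
      | tmul a b => simpa [U, W] using h a b
      | add s t hs ht => rw [map_add, map_add, hs, ht, map_add, map_add]
  have hU : ∀ m : ℕ, (U ^ m) (v ⊗ₜ w) = v ⊗ₜ[k] (D ^ m) w := by
    intro m
    simp only [U, TensorProduct.map_pow, ← Module.End.one_eq_id, one_pow]
    simp
  have hW : ∀ m : ℕ, (W ^ m) (v ⊗ₜ w) = (D ^ m) v ⊗ₜ[k] (σ.toLinearMap ^ m) w := by
    intro m
    simp only [W, TensorProduct.map_pow]
    simp
  have := hcomm n (v ⊗ₜ w)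
  rw [add_pow_of_qcomm_primitive hq hUW, LinearMap.add_apply, hU, hW] at this
  simpa using this

/-- Skew derivations kill scalars, so only products matter. The order of the steps is forced: `gX`
and `xG` on a product use `gG`, the powers of `x` and `X` use `xg` and `GX`, and `xX` uses the mixed
commutations. -/
theorem DRelationsAt.of_adjoin_eq_top {n : ℕ} [NeZero n] {ζ : k} (hζ : IsPrimitiveRoot ζ n)
    {S : Set A} (hS : Algebra.adjoin k S = ⊤) {g G : A →ₐ[k] A} {x X : Module.End k A}
    (hx : IsSkewDerivation g x) (hX : IsSkewDerivation G X)
    (h : ∀ v ∈ S, DRelationsAt n ζ g.toLinearMap x G.toLinearMap X v) (v : A) :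
    DRelationsAt n ζ g.toLinearMap x G.toLinearMap X v := by
  have hζ0 : ζ ≠ 0 := hζ.ne_zero (NeZero.ne n)
  have hxr : ∀ r : k, x (algebraMap k A r) = 0 := fun r => by
    rw [Algebra.algebraMap_eq_smul_one, map_smul, hx.map_one, smul_zero]
  have hXr : ∀ r : k, X (algebraMap k A r) = 0 := fun r => by
    rw [Algebra.algebraMap_eq_smul_one, map_smul, hX.map_one, smul_zero]
  have pow_zero_of : ∀ (D : Module.End k A) (u : A), D u = 0 → (D ^ n) u = 0 := fun D u hu => by
    obtain ⟨m, rfl⟩ : ∃ m, n = m + 1 := ⟨n - 1, by have := NeZero.pos n; omega⟩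
    rw [pow_succ, Module.End.mul_apply, hu, map_zero]
  have pow_mul_of : ∀ (f : A →ₐ[k] A) (m : ℕ) (p q : A),
      (f.toLinearMap ^ m) (p * q) = (f.toLinearMap ^ m) p * (f.toLinearMap ^ m) q := by
    intro f m
    induction m with
    | zero => intro p q; simp
    | succ m ih => intro p q; simp [pow_succ, Module.End.mul_apply, ih]
  have pow_alg_of : ∀ (f : A →ₐ[k] A) (m : ℕ) (r : k),
      (f.toLinearMap ^ m) (algebraMap k A r) = algebraMap k A r := by
    intro f m
    induction m with
    | zero => intro r; simp
    | succ m ih => intro r; simp [pow_succ, Module.End.mul_apply, ih]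
  have ind : ∀ {p : A → Prop}, (∀ v ∈ S, p v) → (∀ r, p (algebraMap k A r)) →
      (∀ v w, p v → p w → p (v + w)) → (∀ v w, p v → p w → p (v * w)) → ∀ v, p v := by
    intro p h1 h2 h3 h4 v
    have hv : v ∈ Algebra.adjoin k S := hS ▸ Algebra.mem_top
    induction hv using Algebra.adjoin_induction with
    | mem v hv => exact h1 v hv
    | algebraMap r => exact h2 r
    | add v w _ _ hv hw => exact h3 v w hv hw
    | mul v w _ _ hv hw => exact h4 v w hv hw
  have xg : ∀ v, x (g v) = ζ • g (x v) := by
    refine ind (fun v hv => (h v hv).xg) (fun r => by simp [hxr]) (fun v w hv hw => ?_)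
      (fun v w hv hw => ?_)
    · simp [hv, hw]
    · rw [map_mul, hx, hx, hv, hw]; simp
  have GX : ∀ v, G (X v) = ζ • X (G v) := by
    refine ind (fun v hv => (h v hv).GX) (fun r => by simp [hXr]) (fun v w hv hw => ?_)
      (fun v w hv hw => ?_)
    · simp [hv, hw]
    · rw [hX, map_mul, hX, map_add, map_mul, map_mul, hv, hw]; simp
  have gG : ∀ v, g (G v) = G (g v) := by
    refine ind (fun v hv => (h v hv).gG) (fun r => by simp) (fun v w hv hw => ?_)
      (fun v w hv hw => ?_)
    · simp [hv, hw]
    · simp [hv, hw]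
  have gX : ∀ v, g (X v) = ζ • X (g v) := by
    refine ind (fun v hv => (h v hv).gX) (fun r => by simp [hXr]) (fun v w hv hw => ?_)
      (fun v w hv hw => ?_)
    · simp [hv, hw]
    · rw [hX, map_mul, hX, map_add, map_mul, map_mul, hv, hw, gG]; simp
  have xG : ∀ v, x (G v) = ζ • G (x v) := by
    refine ind (fun v hv => (h v hv).xG) (fun r => by simp [hxr]) (fun v w hv hw => ?_)
      (fun v w hv hw => ?_)
    · simp [hv, hw]
    · rw [map_mul, hx, hx, map_add, map_mul, map_mul, hv, hw, gG]; simp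
  have g_pow : ∀ v, (g.toLinearMap ^ n) v = v := by
    refine ind (fun v hv => (h v hv).g_pow) (fun r => pow_alg_of g n r) (fun v w hv hw => ?_)
      (fun v w hv hw => ?_)
    · rw [map_add, hv, hw]
    · rw [pow_mul_of, hv, hw]
  have G_pow : ∀ v, (G.toLinearMap ^ n) v = v := by
    refine ind (fun v hv => (h v hv).G_pow) (fun r => pow_alg_of G n r) (fun v w hv hw => ?_)
      (fun v w hv hw => ?_)
    · rw [map_add, hv, hw]
    · rw [pow_mul_of, hv, hw]
  have x_pow : ∀ v, (x ^ n) v = 0 := by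
    refine ind (fun v hv => (h v hv).x_pow) (fun r => pow_zero_of x _ (hxr r))
      (fun v w hv hw => ?_) (fun v w hv hw => ?_)
    · rw [map_add, hv, hw, add_zero]
    · rw [hx.pow hζ xg, hv, hw, mul_zero, zero_mul, add_zero]
  have X_pow : ∀ v, (X ^ n) v = 0 := by
    refine ind (fun v hv => (h v hv).X_pow) (fun r => pow_zero_of X _ (hXr r))
      (fun v w hv hw => ?_) (fun v w hv hw => ?_)
    · rw [map_add, hv, hw, add_zero]
    -- Here `X G = ζ⁻¹ G X`, so the relevant primitive root is `ζ⁻¹`.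
    · rw [hX.pow hζ.inv (fun v => by rw [GX, inv_smul_smul₀ hζ0]), hv, hw, mul_zero, zero_mul,
        add_zero]
  have xX : ∀ v, x (X v) - ζ • X (x v) = ζ • (g (G v) - v) := by
    refine ind (fun v hv => (h v hv).xX) (fun r => by simp [hXr, hxr]) (fun v w hv hw => ?_)
      (fun v w hv hw => ?_)
    · simp only [map_add, smul_add, add_sub_add_comm, hv, hw]
    -- The cross terms `x v * (g (X w) - ζ X (g w))` and `X v * (x (G w) - ζ G (x w))` vanish. What
    -- remains, `v * ζ(gG w - w) + ζ(gG v - v) * gG w`, telescopes.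
    · have hv' : x (X v) = ζ • X (x v) + ζ • (g (G v) - v) := by rw [← hv]; abel
      have hw' : x (X w) = ζ • X (x w) + ζ • (g (G w) - w) := by rw [← hw]; abel
      simp only [hx v, hX v, hx (X v), hX (x v), map_add, xG, gX, hv', hw', map_mul, gG,
        mul_add, add_mul, mul_sub, sub_mul, smul_add, smul_sub, mul_smul_comm,
        smul_mul_assoc]
      abel
  exact ⟨xg v, GX v, gX v, xG v, gG v, g_pow v, G_pow v, x_pow v, X_pow v, xX v⟩

end SkewDerivation

/-! ### Hopf actions from values on generators -/

namespace HopfAction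

variable {k A : Type*} [Field k] [Ring A] [Algebra k A]

/-- This carries the module algebra axiom from two elements of `H` to their product: with `d` and
`t` the coproducts of `a` and `b`, composing the two product rules yields the rule with coproduct `d
* t`. -/
theorem act_map_mul {H : Type*} [Ring H] [Algebra k H] (f : H →ₐ[k] Module.End k A) (a : H)
    {d : H ⊗[k] H} (ha : ∀ p q, f a (p * q) =
      LinearMap.mul' k A (TensorProduct.map (f.toLinearMap.flip p) (f.toLinearMap.flip q) d))
    (t : H ⊗[k] H) (p q : A) :
    f a (LinearMap.mul' k A (TensorProduct.map (f.toLinearMap.flip p) (f.toLinearMap.flip q) t)) =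
      LinearMap.mul' k A
        (TensorProduct.map (f.toLinearMap.flip p) (f.toLinearMap.flip q) (d * t)) := by
  induction t using TensorProduct.induction_on with
  | zero => simp
  | add s t hs ht => rw [mul_add, map_add, map_add, map_add, map_add, map_add, hs, ht]
  | tmul u v =>
    simp only [TensorProduct.map_tmul, LinearMap.mul'_apply, LinearMap.flip_apply,
      AlgHom.toLinearMap_apply]
    rw [ha]
    clear ha
    induction d using TensorProduct.induction_on with
    | zero => simp
    | add s t hs ht => rw [add_mul, map_add, map_add, map_add, map_add, hs, ht]
    | tmul r s => simp

variable {n : ℕ} [NeZero n] {ζ : k} {hζ : IsPrimitiveRoot ζ n}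

section Properties

variable (φ : HopfAction k (DTaft hζ) A)

theorem dRelationsAt (v : A) : DRelationsAt n ζ (φ.act (DTaft.g hζ)) (φ.act (DTaft.x hζ))
    (φ.act (DTaft.G hζ)) (φ.act (DTaft.X hζ)) v :=
  dRelations_iff_forall_at.1 ((DTaft.relations hζ).map φ.act) v

theorem act_g_mul (p q : A) :
    φ.act (DTaft.g hζ) (p * q) = φ.act (DTaft.g hζ) p * φ.act (DTaft.g hζ) q := by
  rw [φ.act_mul, DTaft.comul_g]; simp

theorem act_G_mul (p q : A) :
    φ.act (DTaft.G hζ) (p * q) = φ.act (DTaft.G hζ) p * φ.act (DTaft.G hζ) q := by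
  rw [φ.act_mul, DTaft.comul_G]; simp

theorem act_x_mul : IsSkewDerivation (φ.act (DTaft.g hζ)) (φ.act (DTaft.x hζ)) := fun p q => by
  rw [φ.act_mul, DTaft.comul_x]; simp

theorem act_X_mul : IsSkewDerivation (φ.act (DTaft.G hζ)) (φ.act (DTaft.X hζ)) := fun p q => by
  rw [φ.act_mul, DTaft.comul_X]; simp

theorem act_x_one : φ.act (DTaft.x hζ) 1 = 0 := by
  rw [φ.act_one, DTaft.counit_x, zero_smul]

theorem act_X_one : φ.act (DTaft.X hζ) 1 = 0 := by
  rw [φ.act_one, DTaft.counit_X, zero_smul]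

end Properties

/-- The product rules determine each of the four operators from its values on `S`; those of `x` and
`X` involve `g` and `G`, which are therefore compared first. The four operators in turn determine
the algebra map. -/
theorem ext_of_adjoin_eq_top {S : Set A} (hS : Algebra.adjoin k S = ⊤)
    {φ ψ : HopfAction k (DTaft hζ) A}
    (h : ∀ i, ∀ v ∈ S, φ.act (DTaft.of hζ i) v = ψ.act (DTaft.of hζ i) v) : φ = ψ := by
  have scalar : ∀ (a : DTaft hζ) (r : k), φ.act a (algebraMap k A r) = ψ.act a (algebraMap k A r) :=
    fun a r => by
      rw [Algebra.algebraMap_eq_smul_one, map_smul, map_smul, φ.act_one, ψ.act_one]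
  have ind : ∀ a : DTaft hζ, (∀ v ∈ S, φ.act a v = ψ.act a v) →
      (∀ v w, φ.act a v = ψ.act a v → φ.act a w = ψ.act a w → φ.act a (v * w) = ψ.act a (v * w)) →
      φ.act a = ψ.act a := by
    intro a h1 h2
    ext v
    have hv : v ∈ Algebra.adjoin k S := hS ▸ Algebra.mem_top
    induction hv using Algebra.adjoin_induction with
    | mem v hv => exact h1 v hv
    | algebraMap r => exact scalar a r
    | add v w _ _ hv hw => rw [map_add, map_add, hv, hw]
    | mul v w _ _ hv hw => exact h2 v w hv hw
  have hg := ind _ (h .g) fun v w hv hw => by rw [φ.act_g_mul, ψ.act_g_mul, hv, hw]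
  have hG := ind _ (h .G) fun v w hv hw => by rw [φ.act_G_mul, ψ.act_G_mul, hv, hw]
  have hx := ind _ (h .x) fun v w hv hw => by rw [φ.act_x_mul, ψ.act_x_mul, hv, hw, hg]
  have hX := ind _ (h .X) fun v w hv hw => by rw [φ.act_X_mul, ψ.act_X_mul, hv, hw, hG]
  exact HopfAction.ext (DTaft.algHom_ext hζ hg hx hG hX)

/-- Operators `g, G, x, X` on `A` define an action of `D(T(n))` if `g, G` are endomorphisms, `x, X`
are skew derivations, and the relations hold on a generating set. -/
theorem exists_of_generators {S : Set A} (hS : Algebra.adjoin k S = ⊤) {g G : A →ₐ[k] A}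
    {x X : Module.End k A} (hx : IsSkewDerivation g x) (hX : IsSkewDerivation G X)
    (h : ∀ v ∈ S, DRelationsAt n ζ g.toLinearMap x G.toLinearMap X v) :
    ∃ φ : HopfAction k (DTaft hζ) A, φ.act (DTaft.g hζ) = g.toLinearMap ∧
      φ.act (DTaft.x hζ) = x ∧ φ.act (DTaft.G hζ) = G.toLinearMap ∧ φ.act (DTaft.X hζ) = X := by
  have r : DRelations n ζ g.toLinearMap x G.toLinearMap X :=
    dRelations_iff_forall_at.2 (DRelationsAt.of_adjoin_eq_top hζ hS hx hX h)
  -- Both module algebra axioms are inherited by sums and products in `D(T(n))`, so they come down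
  -- to multiplicativity of `g`, `G` and the Leibniz rules of `x`, `X`.
  refine ⟨⟨DTaft.lift hζ r, fun a => ?_, fun a => ?_⟩, DTaft.lift_g hζ r, DTaft.lift_x hζ r,
    DTaft.lift_G hζ r, DTaft.lift_X hζ r⟩
  · induction a using DTaft.induction with
    | scalar s =>
      intro p q
      rw [Bialgebra.comul_algebraMap, Algebra.TensorProduct.algebraMap_apply]
      simp [Algebra.algebraMap_eq_smul_one]
    | gen i =>
      intro p q
      cases i
      · rw [DTaft.comul_g]; simp
      · rw [DTaft.comul_x]; simpa using hx p q
      · rw [DTaft.comul_G]; simp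
      · rw [DTaft.comul_X]; simpa using hX p q
    | mul a b ha hb =>
      intro p q
      rw [map_mul (DTaft.lift hζ r) a b, Module.End.mul_apply, hb, Bialgebra.comul_mul]
      exact act_map_mul _ a ha _ p q
    | add a b ha hb =>
      intro p q
      rw [map_add, LinearMap.add_apply, ha, hb, map_add, map_add, map_add]
  · induction a using DTaft.induction with
    | scalar s => simp [Algebra.algebraMap_eq_smul_one]
    | gen i =>
      cases i
      · rw [DTaft.counit_g]; simp
      · rw [DTaft.counit_x]; simpa using hx.map_one
      · rw [DTaft.counit_G]; simp
      · rw [DTaft.counit_X]; simpa using hX.map_one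
    | mul a b ha hb =>
      rw [map_mul, Module.End.mul_apply, hb, map_smul, ha, Bialgebra.counit_mul, smul_smul,
        mul_comm]
    | add a b ha hb => rw [map_add, LinearMap.add_apply, ha, hb, map_add, add_smul]

end HopfAction

end DTaftActions

/-! ### Constructing maps out of path algebras -/

section PathAlgebraMaps

namespace PathAlgebra

variable {k V : Type*} [Field k] [Fintype V] [Quiver V]

theorem sum_vertex : ∑ v : V, vertex k v = 1 := by
  have := RingQuot.mkAlgHom_rel k (PathRel.sum_vertex (k := k) (V := V))
  rw [map_sum, map_one] at this
  exact this

theorem vertex_mul_self (v : V) : vertex k v * vertex k v = vertex k v := by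
  have := RingQuot.mkAlgHom_rel k (PathRel.idem (k := k) v)
  rw [map_mul] at this
  exact this

theorem vertex_mul_of_ne {u v : V} (h : u ≠ v) : vertex k u * vertex k v = 0 := by
  have := RingQuot.mkAlgHom_rel k (PathRel.orth (k := k) u v h)
  rw [map_mul, map_zero] at this
  exact this

theorem vertex_mul_arrow {u v : V} (α : u ⟶ v) : vertex k u * arrow k α = arrow k α := by
  have := RingQuot.mkAlgHom_rel k (PathRel.source (k := k) ⟨u, v, α⟩)
  rw [map_mul] at this
  exact this

theorem arrow_mul_vertex {u v : V} (α : u ⟶ v) : arrow k α * vertex k v = arrow k α := by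
  have := RingQuot.mkAlgHom_rel k (PathRel.target (k := k) ⟨u, v, α⟩)
  rw [map_mul] at this
  exact this

theorem vertex_mul_arrow_of_ne {u v w : V} (h : w ≠ u) (α : u ⟶ v) :
    vertex k w * arrow k α = 0 := by
  rw [← vertex_mul_arrow α, ← mul_assoc, vertex_mul_of_ne h, zero_mul]

variable (k V) in
/-- The trivial paths and the arrows. -/
def generators : Set (PathAlgebra k V) :=
  {z | (∃ v, z = vertex k v) ∨ ∃ (u v : V) (α : u ⟶ v), z = arrow k α}

theorem adjoin_generators : Algebra.adjoin k (generators k V) = ⊤ := by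
  refine Algebra.eq_top_iff.2 fun z => ?_
  obtain ⟨z, rfl⟩ := RingQuot.mkAlgHom_surjective k (PathRel k V) z
  induction z using FreeAlgebra.induction with
  | grade0 r => rw [AlgHom.commutes]; exact Subalgebra.algebraMap_mem _ r
  | grade1 i =>
    refine Algebra.subset_adjoin ?_
    rcases i with v | ⟨u, v, α⟩
    · exact .inl ⟨v, rfl⟩
    · exact .inr ⟨u, v, α, rfl⟩
  | mul a b ha hb => rw [map_mul]; exact Subalgebra.mul_mem _ ha hb
  | add a b ha hb => rw [map_add]; exact Subalgebra.add_mem _ ha hb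

/-- The universal property of the path algebra. -/
theorem exists_lift {B : Type*} [Ring B] [Algebra k B] (f : V → B) (h : ∀ {u v : V}, (u ⟶ v) → B)
    (hsum : ∑ v, f v = 1) (hidem : ∀ v, f v * f v = f v) (horth : ∀ u v, u ≠ v → f u * f v = 0)
    (hs : ∀ {u v : V} (α : u ⟶ v), f u * h α = h α)
    (ht : ∀ {u v : V} (α : u ⟶ v), h α * f v = h α) :
    ∃ F : PathAlgebra k V →ₐ[k] B,
      (∀ v, F (vertex k v) = f v) ∧ ∀ {u v : V} (α : u ⟶ v), F (arrow k α) = h α := by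
  let f₀ : V ⊕ Quiver.Total V → B := Sum.elim f fun a => h a.hom
  let F : PathAlgebra k V →ₐ[k] B := RingQuot.liftAlgHom k ⟨FreeAlgebra.lift k f₀, by
    intro a b r
    cases r
    · simpa [f₀] using hsum
    · simpa [f₀] using hidem _
    · simpa [f₀] using horth _ _ ‹_›
    · simpa [f₀] using hs _
    · simpa [f₀] using ht _⟩
  refine ⟨F, fun v => ?_, fun {u v} α => ?_⟩
  · exact (RingQuot.liftAlgHom_mkAlgHom_apply ..).trans (FreeAlgebra.lift_ι_apply ..)
  · exact (RingQuot.liftAlgHom_mkAlgHom_apply ..).trans (FreeAlgebra.lift_ι_apply ..)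

/-- The representation of the path algebra on the free module on the vertices in which every arrow
acts as a matrix unit. -/
theorem exists_matrix_representation (k V : Type*) [Field k] [Fintype V] [Quiver V]
    [DecidableEq V] :
    ∃ F : PathAlgebra k V →ₐ[k] Matrix V V k, (∀ v, F (vertex k v) = Matrix.single v v 1) ∧
      ∀ {u v : V} (α : u ⟶ v), F (arrow k α) = Matrix.single u v 1 := by
  refine exists_lift (fun v => Matrix.single v v 1) (fun {u v} _ => Matrix.single u v 1) ?_ ?_ ?_
    ?_ ?_
  · ext i j
    rw [Matrix.sum_apply]
    simp [Matrix.single, Matrix.one_apply, ite_and]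
  · intro v; simp
  · intro u v h; simp [h]
  · intro u v _; simp
  · intro u v _; simp

/-! ### Twisted endomorphisms and skew derivations of path algebras -/

section Twist

variable (τ : Equiv.Perm V)

/-- An endomorphism of the path algebra that permutes the trivial paths. -/
theorem exists_twist (f : ∀ {u v : V}, (u ⟶ v) → PathAlgebra k V)
    (hs : ∀ {u v : V} (α : u ⟶ v), vertex k (τ u) * f α = f α)
    (ht : ∀ {u v : V} (α : u ⟶ v), f α * vertex k (τ v) = f α) :
    ∃ σ : PathAlgebra k V →ₐ[k] PathAlgebra k V,
    (∀ v, σ (vertex k v) = vertex k (τ v)) ∧ ∀ {u v : V} (α : u ⟶ v), σ (arrow k α) = f α := by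
  refine exists_lift (fun v => vertex k (τ v)) f ?_ ?_ ?_ hs ht
  · rw [Equiv.sum_comp τ (fun v => vertex k v), sum_vertex]
  · intro v; exact vertex_mul_self _
  · intro u v h; exact vertex_mul_of_ne (τ.injective.ne h)

/-- A skew derivation of the path algebra that kills the trivial paths. -/
theorem exists_skewDerivation_zero {σ : PathAlgebra k V →ₐ[k] PathAlgebra k V}
    (hσ : ∀ v, σ (vertex k v) = vertex k (τ v)) (d : ∀ {u v : V}, (u ⟶ v) → PathAlgebra k V)
    (hs : ∀ {u v : V} (α : u ⟶ v), vertex k u * d α = d α)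
    (ht : ∀ {u v : V} (α : u ⟶ v), d α * vertex k (τ v) = d α) :
    ∃ D : Module.End k (PathAlgebra k V), IsSkewDerivation σ D ∧
      (∀ v, D (vertex k v) = 0) ∧ ∀ {u v : V} (α : u ⟶ v), D (arrow k α) = d α := by
  -- A map `z ↦ (z, D z; 0, σ z)` into upper triangular matrices is multiplicative exactly when `D`
  -- is a `σ`-skew derivation, so the universal property of the path algebra also produces skew
  -- derivations.
  obtain ⟨Φ, hv, ha⟩ := exists_lift (k := k) (V := V)
    (B := Matrix (Fin 2) (Fin 2) (PathAlgebra k V))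
    (fun v => !![vertex k v, 0; 0, vertex k (τ v)])
    (fun α => !![arrow k α, d α; 0, σ (arrow k α)])
    (by
      ext i j
      rw [Matrix.sum_apply]
      fin_cases i <;> fin_cases j
      · simp [sum_vertex]
      · simp
      · simp
      · simpa using (Equiv.sum_comp τ (fun v => vertex k v)).trans sum_vertex)
    (by intro v; simp [vertex_mul_self])
    (by
      intro u v h
      rw [Matrix.mul_fin_two]
      simp only [vertex_mul_of_ne h, vertex_mul_of_ne (τ.injective.ne h), mul_zero, zero_mul,
        add_zero]
      ext i j; fin_cases i <;> fin_cases j <;> rfl)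
    (by
      intro u v α
      simp [vertex_mul_arrow, hs, ← hσ, ← map_mul])
    (by
      intro u v α
      rw [Matrix.mul_fin_two]
      simp only [arrow_mul_vertex, ht, mul_zero, zero_mul, add_zero, zero_add]
      rw [← hσ, ← map_mul, arrow_mul_vertex])
  have key : ∀ z, Φ z 0 0 = z ∧ Φ z 1 0 = 0 ∧ Φ z 1 1 = σ z := by
    intro z
    have hz : z ∈ Algebra.adjoin k (generators k V) := by
      rw [adjoin_generators]; exact Algebra.mem_top
    induction hz using Algebra.adjoin_induction with
    | mem z hz =>
      rcases hz with ⟨v, rfl⟩ | ⟨u, v, α, rfl⟩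
      · simp [hv, hσ]
      · simp [ha]
    | algebraMap r => simp [Matrix.algebraMap_matrix_apply]
    | add z w _ _ hz hw => simp [hz, hw]
    | mul z w _ _ hz hw => simp [Matrix.mul_apply, Fin.sum_univ_two, hz, hw]
  refine ⟨(Matrix.entryLinearMap k (PathAlgebra k V) 0 1) ∘ₗ Φ.toLinearMap, fun p q => ?_,
    fun v => ?_, fun {u v} α => ?_⟩
  · simp [Matrix.mul_apply, Fin.sum_univ_two, key]
  · simp [hv]
  · simp [ha]

/-- Skew derivations of Taft type on the path algebra: the trivial path at `v` is sent to
`w v e_v - w (τ v) e_{τ v}`. -/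
theorem exists_skewDerivation {σ : PathAlgebra k V →ₐ[k] PathAlgebra k V}
    (hσ : ∀ v, σ (vertex k v) = vertex k (τ v)) (w : V → k)
    (d : ∀ {u v : V}, (u ⟶ v) → PathAlgebra k V)
    (hs : ∀ {u v : V} (α : u ⟶ v), vertex k u * d α = d α)
    (ht : ∀ {u v : V} (α : u ⟶ v), d α * vertex k (τ v) = d α) :
    ∃ D : Module.End k (PathAlgebra k V), IsSkewDerivation σ D ∧
      (∀ v, D (vertex k v) = w v • vertex k v - w (τ v) • vertex k (τ v)) ∧
      ∀ {u v : V} (α : u ⟶ v),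
        D (arrow k α) = w v • arrow k α - w (τ u) • σ (arrow k α) + d α := by
  classical
  obtain ⟨L, hL, hLv, hLa⟩ := exists_skewDerivation_zero τ hσ d hs ht
  -- The map `p ↦ p W - W σ(p)` is an inner skew derivation; on the trivial path at `v` it gives the
  -- prescribed `w v e_v - w (τ v) e_{τ v}`.
  let W : PathAlgebra k V := ∑ v, w v • vertex k v
  have hvW : ∀ v, vertex k v * W = w v • vertex k v := fun v => by
    rw [Finset.mul_sum, Finset.sum_eq_single v]
    · rw [mul_smul_comm, vertex_mul_self]
    · intro u _ h; rw [mul_smul_comm, vertex_mul_of_ne h.symm, smul_zero]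
    · simp
  have hWv : ∀ v, W * vertex k v = w v • vertex k v := fun v => by
    rw [Finset.sum_mul, Finset.sum_eq_single v]
    · rw [smul_mul_assoc, vertex_mul_self]
    · intro u _ h; rw [smul_mul_assoc, vertex_mul_of_ne h, smul_zero]
    · simp
  refine ⟨LinearMap.mulRight k W - LinearMap.mulLeft k W ∘ₗ σ.toLinearMap + L, fun p q => ?_,
    fun v => ?_, fun {u v} α => ?_⟩
  · simp only [LinearMap.add_apply, LinearMap.sub_apply, LinearMap.mulRight_apply,
      LinearMap.comp_apply, AlgHom.toLinearMap_apply, LinearMap.mulLeft_apply, hL p q, map_mul,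
      mul_add, mul_sub, add_mul, sub_mul, mul_assoc]
    abel
  · simp [hvW, hσ, hWv, hLv]
  · have h1 : arrow k α * W = w v • arrow k α := by
      rw [← arrow_mul_vertex α, mul_assoc, hvW, mul_smul_comm]
    have h2 : W * σ (arrow k α) = w (τ u) • σ (arrow k α) := by
      rw [← vertex_mul_arrow α, map_mul, hσ, ← mul_assoc, hWv, smul_mul_assoc]
    simp [h1, h2, hLa]

end Twist

/-! ### The path length filtration -/

section Filtration

theorem filtration_mono {m m' : ℕ} (h : m ≤ m') : filtration k V m ≤ filtration k V m' :=
  Submodule.span_mono fun _ ⟨i, j, p, hp, hz⟩ => ⟨i, j, p, hp.trans h, hz⟩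

theorem vertex_mem_filtration (v : V) (m : ℕ) : vertex k v ∈ filtration k V m :=
  Submodule.subset_span ⟨v, v, .nil, by simp, rfl⟩

theorem arrow_mem_filtration {u v : V} (α : u ⟶ v) : arrow k α ∈ filtration k V 1 :=
  Submodule.subset_span ⟨u, v, (Quiver.Path.nil).cons α, by simp, (vertex_mul_arrow α).symm⟩

theorem ofPath_mul_vertex {u v : V} (p : Quiver.Path u v) :
    ofPath k p * vertex k v = ofPath k p := by
  cases p with
  | nil => exact vertex_mul_self _
  | cons p α => rw [ofPath, mul_assoc, arrow_mul_vertex]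

/-- A product of two paths is a path or zero. A second factor of length at most one suffices, as
paths grow one arrow at a time. -/
theorem mul_mem_filtration {m : ℕ} {y z : PathAlgebra k V} (hy : y ∈ filtration k V m)
    (hz : z ∈ filtration k V 1) : y * z ∈ filtration k V (m + 1) := by
  classical
  have h : filtration k V m * filtration k V 1 ≤ filtration k V (m + 1) := by
    rw [filtration, filtration, Submodule.span_mul_span, Submodule.span_le]
    rintro _ ⟨_, ⟨u, v, p, hp, rfl⟩, _, ⟨u', v', q, hq, rfl⟩, rfl⟩
    change ofPath k p * ofPath k q ∈ filtration k V (m + 1)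
    cases q with
    | nil =>
      by_cases h : v = u'
      · subst h
        rw [ofPath, ofPath_mul_vertex]
        exact Submodule.subset_span ⟨_, _, p, hp.trans (Nat.le_succ m), rfl⟩
      · rw [ofPath, ← ofPath_mul_vertex, mul_assoc, vertex_mul_of_ne h, mul_zero]
        exact Submodule.zero_mem _
    | cons q α =>
      cases q with
      | cons q β => simp at hq
      | nil =>
        rw [ofPath, ofPath, vertex_mul_arrow]
        by_cases h : v = u'
        · subst h
          exact Submodule.subset_span ⟨_, _, p.cons α, by simpa using hp, rfl⟩
        · rw [← ofPath_mul_vertex, mul_assoc, vertex_mul_arrow_of_ne h, mul_zero]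
          exact Submodule.zero_mem _
  exact h (Submodule.mul_mem_mul hy hz)

/-- An endomorphism preserves the filtration if it does so on the generators. -/
theorem algHom_mem_filtration {σ : PathAlgebra k V →ₐ[k] PathAlgebra k V}
    (hv : ∀ v, σ (vertex k v) ∈ filtration k V 0)
    (ha : ∀ {u v : V} (α : u ⟶ v), σ (arrow k α) ∈ filtration k V 1) {u v : V}
    (p : Quiver.Path u v) : σ (ofPath k p) ∈ filtration k V p.length := by
  induction p with
  | nil => exact hv u
  | cons p α ih => rw [ofPath, map_mul]; exact mul_mem_filtration ih (ha α)

/-- A skew derivation preserves the filtration if it does so on the generators. -/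
theorem skewDerivation_mem_filtration {σ : PathAlgebra k V →ₐ[k] PathAlgebra k V}
    {D : Module.End k (PathAlgebra k V)} (hD : IsSkewDerivation σ D)
    (hσa : ∀ {u v : V} (α : u ⟶ v), σ (arrow k α) ∈ filtration k V 1)
    (hv : ∀ v, D (vertex k v) ∈ filtration k V 0)
    (ha : ∀ {u v : V} (α : u ⟶ v), D (arrow k α) ∈ filtration k V 1) {u v : V}
    (p : Quiver.Path u v) : D (ofPath k p) ∈ filtration k V p.length := by
  induction p with
  | nil => exact hv u
  | cons p α ih =>
    rw [ofPath, hD]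
    exact Submodule.add_mem _
      (mul_mem_filtration (Submodule.subset_span ⟨_, _, p, le_rfl, rfl⟩) (ha α))
      (mul_mem_filtration ih (hσa α))

/-- The elements of `D(T(n))` that preserve every filtration step form a subalgebra. -/
theorem filtered_of_generators {n : ℕ} [NeZero n] {ζ : k} {hζ : IsPrimitiveRoot ζ n}
    (φ : HopfAction k (DTaft hζ) (PathAlgebra k V))
    (h : ∀ (i : DGen) {u v : V} (p : Quiver.Path u v),
      φ.act (DTaft.of hζ i) (ofPath k p) ∈ filtration k V p.length) : Filtered φ := by
  intro a
  induction a using DTaft.induction with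
  | scalar r =>
    intro m z hz
    rw [AlgHom.commutes, Module.algebraMap_end_apply]
    exact Submodule.smul_mem _ r hz
  | gen i =>
    intro m z hz
    have : filtration k V m ≤ (filtration k V m).comap (φ.act (DTaft.of hζ i)) := by
      conv_lhs => rw [filtration]
      rw [Submodule.span_le]
      rintro _ ⟨u, v, p, hp, rfl⟩
      exact filtration_mono hp (h i p)
    exact this hz
  | mul a b ha hb =>
    intro m z hz
    rw [map_mul]
    exact ha m _ (hb m z hz)
  | add a b ha hb =>
    intro m z hz
    rw [map_add]
    exact Submodule.add_mem _ (ha m z hz) (hb m z hz)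

end Filtration

end PathAlgebra

end PathAlgebraMaps

/-! ### The n-th power of a Taft-type operator, via weighted shifts -/

section OrbitModel

section RootPow

variable {k : Type*} [Field k] {n : ℕ} {ζ : k}

theorem rootPow_add_natCast [NeZero n] (h : ζ ^ n = 1) (i : ZMod n) (m : ℕ) :
    rootPow ζ (i + (m : ZMod n)) = rootPow ζ i * ζ ^ m := by
  rw [rootPow, rootPow, ZMod.val_add, ZMod.val_natCast, ← pow_eq_pow_mod _ h, pow_add,
    ← pow_eq_pow_mod _ h]

theorem rootPow_add_one [NeZero n] (h : ζ ^ n = 1) (i : ZMod n) : rootPow ζ (i + 1) = ζ * rootPow ζ i := by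
  have := rootPow_add_natCast h i 1
  rwa [Nat.cast_one, pow_one, mul_comm] at this

theorem rootPow_inv (i : ZMod n) : rootPow ζ⁻¹ i = (rootPow ζ i)⁻¹ := inv_pow ζ _

theorem rootPow_ne_zero (h : ζ ≠ 0) (i : ZMod n) : rootPow ζ i ≠ 0 := pow_ne_zero _ h

theorem rootPow_pow (h : ζ ^ n = 1) (i : ZMod n) : rootPow ζ i ^ n = 1 := by
  rw [rootPow, ← pow_mul, mul_comm, pow_mul, h, one_pow]

/-- This is the constant term of `T ^ n - 1 = ∏ (T - ζ ^ m)`. The proof evaluates the exponent `n (n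
- 1) / 2` by parity: for even `n` one uses `ζ ^ (n / 2) = -1`. -/
theorem IsPrimitiveRoot.neg_one_pow_mul_prod_pow [NeZero n] (h : IsPrimitiveRoot ζ n) :
    (-1) ^ n * ∏ m ∈ Finset.range n, ζ ^ m = -1 := by
  have hn := NeZero.pos n
  rw [Finset.prod_pow_eq_pow_sum]
  have h2 := Finset.sum_range_id_mul_two n
  rcases Nat.even_or_odd' n with ⟨m, hm | hm⟩
  · have e : ∑ i ∈ Finset.range n, i = m * (n - 1) := by
      have : m * (n - 1) * 2 = n * (n - 1) := by rw [hm]; ring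
      omega
    have h3 : IsPrimitiveRoot (ζ ^ m) 2 := h.pow hn (by omega)
    have h4 : Odd (n - 1) := by rw [Nat.odd_iff]; omega
    rw [e, pow_mul, h3.eq_neg_one_of_two_right, h4.neg_one_pow, Even.neg_one_pow ⟨m, by omega⟩,
      one_mul]
  · have e : ∑ i ∈ Finset.range n, i = n * m := by
      have : n * m * 2 = n * (n - 1) := by rw [hm, Nat.add_sub_cancel]; ring
      omega
    rw [e, pow_mul, h.pow_eq_one, one_pow, mul_one, Odd.neg_one_pow ⟨m, hm⟩]

/-- Evaluates the n-th power of the rotation term of `x`: the signs and the roots of unity combine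
to a single minus sign, whatever `n` and the starting index. -/
theorem prod_neg_mul_rootPow [NeZero n] (h : IsPrimitiveRoot ζ n) (γ : k) (i : ZMod n) (μ : ℕ → k) :
    ∏ m ∈ Finset.range n, -(γ * rootPow ζ (i + (m : ZMod n)) * μ m) =
      -(γ ^ n * ∏ m ∈ Finset.range n, μ m) := by
  have e : ∀ m : ℕ, -(γ * rootPow ζ (i + (m : ZMod n)) * μ m) =
      (-1) * (γ * rootPow ζ i) * (ζ ^ m) * μ m :=
    fun m => by rw [rootPow_add_natCast h.pow_eq_one]; ring
  simp only [e, Finset.prod_mul_distrib, Finset.prod_const, Finset.card_range,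
    rootPow_pow h.pow_eq_one]
  linear_combination (γ ^ n * ∏ m ∈ Finset.range n, μ m) * h.neg_one_pow_mul_prod_pow

end RootPow

section WeightedShift

variable {k ι : Type*} [Field k]

/-- The operator `e_p ↦ c_p e_{f(p)}` on the free module. -/
noncomputable def weightedShift (c : ι → k) (f : ι → ι) : Module.End k (ι →₀ k) :=
  Finsupp.linearCombination k fun p => c p • Finsupp.single (f p) 1

theorem weightedShift_single (c : ι → k) (f : ι → ι) (p : ι) :
    weightedShift c f (Finsupp.single p 1) = c p • Finsupp.single (f p) 1 := by
  simp [weightedShift]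

theorem weightedShift_pow_single (c : ι → k) (f : ι → ι) (m : ℕ) (p : ι) :
    (weightedShift c f ^ m) (Finsupp.single p 1) =
      (∏ t ∈ Finset.range m, c (f^[t] p)) • Finsupp.single (f^[m] p) 1 := by
  induction m with
  | zero => simp
  | succ m ih =>
    rw [pow_succ', Module.End.mul_apply, ih, map_smul, weightedShift_single, smul_smul,
      Finset.prod_range_succ, Function.iterate_succ_apply']

theorem weightedShift_qcomm {q : k} {c d : ι → k} {f f' : ι → ι} (hf : ∀ p, f (f' p) = f' (f p))
    (h : ∀ p, d p * c (f' p) = q * (c p * d (f p))) :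
    weightedShift c f * weightedShift d f' = q • (weightedShift d f' * weightedShift c f) := by
  refine Finsupp.lhom_ext' fun p => LinearMap.ext_ring ?_
  simp only [LinearMap.comp_apply, Finsupp.lsingle_apply, LinearMap.smul_apply,
    Module.End.mul_apply, weightedShift_single, map_smul, smul_smul, hf, h]

end WeightedShift

variable {k A : Type*} [Field k] [AddCommGroup A] [Module k A] {n : ℕ}

theorem iterate_pow_apply {a : ZMod n → ZMod n → A} {μ : ZMod n → ZMod n → k} {g : Module.End k A}
    (hg : ∀ i j, g (a i j) = μ i j • a (i + 1) (j + 1)) (m : ℕ) (i j : ZMod n) :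
    (g ^ m) (a i j) = (∏ l ∈ Finset.range m, μ (i + l) (j + l)) • a (i + m) (j + m) := by
  induction m with
  | zero => simp
  | succ m ih =>
    rw [pow_succ', Module.End.mul_apply, ih, map_smul, hg, smul_smul, Finset.prod_range_succ]
    push_cast
    rw [add_assoc, add_assoc]

/-- The operators `x` of the Taft-type formulas, with parameter `γs` at the source and `γt` at the
target. -/
def IsTaftOperator (a : ZMod n → ZMod n → A) (ζ γs γt : k) (μ l : ZMod n → ZMod n → k)
    (x : Module.End k A) : Prop :=
  ∀ i j, x (a i j) = (γt * rootPow ζ j) • a i j - (γs * rootPow ζ (i + 1) * μ i j) • a (i + 1) (j + 1)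
    + l i j • a i (j + 1)

/-- The diagonal terms cancel because a rotation multiplies `rootPow ζ j` by `ζ`, the rotation terms
because of `hc`; only the `λ` terms survive. The weights `ν` of `f` are independent of `μ` so that
the lemma serves `g` and `G` against both `x` and `X`. -/
theorem IsTaftOperator.comm_apply [NeZero n] {a : ZMod n → ZMod n → A} {ζ γs γt : k}
    {μ ν l : ZMod n → ZMod n → k} {x f : Module.End k A} (hζ : ζ ^ n = 1)
    (hx : IsTaftOperator a ζ γs γt μ l x)
    (hf : ∀ i j, f (a i j) = ν i j • a (i + 1) (j + 1)) {i j : ZMod n}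
    (hc : ν i j * μ (i + 1) (j + 1) = μ i j * ν (i + 1) (j + 1)) :
    x (f (a i j)) - ζ • f (x (a i j)) =
      (ν i j * l (i + 1) (j + 1) - ζ * ν i (j + 1) * l i j) • a (i + 1) (j + 1 + 1) := by
  simp only [hf, hx i j, hx (i + 1), map_smul, map_add, map_sub, rootPow_add_one hζ]
  match_scalars
  · ring
  · linear_combination (-γs * ζ * ζ * rootPow ζ i) * hc
  · ring

/-- The diagonal term `K`, the shift `L` and the rotation `S` pairwise `ζ`-commute, the pair `L`,
`S` by hypothesis `h`. Applying the q-binomial theorem twice leaves only their n-th powers, each of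
which returns to its starting index. -/
theorem IsTaftOperator.pow_apply [NeZero n] {a : ZMod n → ZMod n → A} {ζ γs γt : k}
    {μ l : ZMod n → ZMod n → k} {x : Module.End k A} (hζ : IsPrimitiveRoot ζ n)
    (hx : IsTaftOperator a ζ γs γt μ l x)
    (h : ∀ i j, ζ * μ i (j + 1) * l i j = μ i j * l (i + 1) (j + 1)) (i j : ZMod n) :
    (x ^ n) (a i j) = (γt ^ n - γs ^ n * ∏ m ∈ Finset.range n, μ (i + m) (j + m)
      + ∏ m ∈ Finset.range n, l i (j + m)) • a i j := by
  let K : Module.End k (ZMod n × ZMod n →₀ k) := weightedShift (fun p => γt * rootPow ζ p.2) id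
  let L : Module.End k (ZMod n × ZMod n →₀ k) :=
    weightedShift (fun p => l p.1 p.2) (fun p => (p.1, p.2 + 1))
  let S : Module.End k (ZMod n × ZMod n →₀ k) :=
    weightedShift (fun p => -(γs * rootPow ζ (p.1 + 1) * μ p.1 p.2))
      (fun p => (p.1 + 1, p.2 + 1))
  -- The summands of `x` need not be operators on `A`, since the `a i j` may vanish or be dependent.
  -- They are operators on the free module, and `T` transports their sum to `x`.
  let T : (ZMod n × ZMod n →₀ k) →ₗ[k] A := Finsupp.linearCombination k fun p => a p.1 p.2
  have hT : ∀ p : ZMod n × ZMod n, T (Finsupp.single p 1) = a p.1 p.2 := fun p => by simp [T]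
  have hKL : K * L = ζ • (L * K) := weightedShift_qcomm (fun p => rfl) fun p => by
    simp only [rootPow_add_one hζ.pow_eq_one, id]; ring
  have hKS : K * S = ζ • (S * K) := weightedShift_qcomm (fun p => rfl) fun p => by
    simp only [rootPow_add_one hζ.pow_eq_one, id]; ring
  have hLS : L * S = ζ • (S * L) := weightedShift_qcomm (fun p => rfl) fun p => by
    linear_combination (γs * rootPow ζ (p.1 + 1)) * h p.1 p.2
  have hKLS : (K + L) * S = ζ • (S * (K + L)) := by rw [add_mul, mul_add, hKS, hLS, smul_add]
  have hxT : ∀ v, x (T v) = T ((K + L + S) v) := by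
    intro v
    refine LinearMap.congr_fun (f := x ∘ₗ T) (g := T ∘ₗ (K + L + S)) ?_ v
    refine Finsupp.lhom_ext' fun p => LinearMap.ext_ring ?_
    simp only [LinearMap.comp_apply, Finsupp.lsingle_apply, LinearMap.add_apply, hT, hx p.1 p.2, K,
      L, S, weightedShift_single, map_add, map_smul, id]
    module
  have hxmT : ∀ (m : ℕ) v, (x ^ m) (T v) = T (((K + L + S) ^ m) v) := by
    intro m
    induction m with
    | zero => intro v; simp
    | succ m ih => intro v; rw [pow_succ, Module.End.mul_apply, hxT, ih, pow_succ,
        Module.End.mul_apply]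
  have hit1 : ∀ m : ℕ, (fun p : ZMod n × ZMod n => (p.1, p.2 + 1))^[m] (i, j) = (i, j + m) := by
    intro m
    induction m with
    | zero => simp
    | succ m ih => rw [Function.iterate_succ_apply', ih]; simp [add_assoc]
  have hit2 : ∀ m : ℕ, (fun p : ZMod n × ZMod n => (p.1 + 1, p.2 + 1))^[m] (i, j)
      = (i + m, j + m) := by
    intro m
    induction m with
    | zero => simp
    | succ m ih => rw [Function.iterate_succ_apply', ih]; simp [add_assoc]
  have hpow : (K + L + S) ^ n = K ^ n + L ^ n + S ^ n := by
    rw [add_pow_of_qcomm_primitive (A := Module.End k (ZMod n × ZMod n →₀ k)) hζ hKLS,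
      add_pow_of_qcomm_primitive (A := Module.End k (ZMod n × ZMod n →₀ k)) hζ hKL]
  rw [← hT (i, j), hxmT, hpow]
  simp only [K, L, S, LinearMap.add_apply, weightedShift_pow_single, hit1, hit2,
    Function.iterate_id, id, CharP.cast_eq_zero, add_zero]
  have e := prod_neg_mul_rootPow hζ γs (i + 1) (fun m => μ (i + m) (j + m))
  simp only [add_right_comm i 1] at e
  rw [e, Finset.prod_const, Finset.card_range, mul_pow, rootPow_pow hζ.pow_eq_one, mul_one]
  rw [← add_smul, ← add_smul, map_smul, hT]
  congr 1
  ring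

end OrbitModel

/-! ### The relations on an orbit family, translated into conditions on scalars -/

section OrbitRelations

variable {k A : Type*} [Field k] [AddCommGroup A] [Module k A] {n : ℕ} [NeZero n]

/-- Of the six positions that occur, `(i + 1, j + 1)` and `(i, j + 1)` cancel identically, and `(i +
1, j + 2)` cancels by the two mixed commutation conditions. The term `ζ (g G - 1)` enters at `(i +
2, j + 2)` and `(i, j)`. -/
theorem IsTaftOperator.sub_apply {a : ZMod n → ZMod n → A} {ζ γs γt γs' γt' : k}
    {s : ArrowScalars k n} {g x G X : Module.End k A} (hζ : IsPrimitiveRoot ζ n)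
    (hg : ∀ i j, g (a i j) = s.μg i j • a (i + 1) (j + 1))
    (hG : ∀ i j, G (a i j) = s.μG i j • a (i + 1) (j + 1))
    (hx : IsTaftOperator a ζ γs γt s.μg s.lx x) (hX : IsTaftOperator a ζ⁻¹ γs' γt' s.μG s.lX X)
    {i j : ZMod n} (hc : s.μG i j * s.μg (i + 1) (j + 1) = s.μg i j * s.μG (i + 1) (j + 1))
    (hgX : s.μg i (j + 1) * s.lX i j = ζ * s.μg i j * s.lX (i + 1) (j + 1))
    (hxG : ζ * s.μG i (j + 1) * s.lx i j = s.μG i j * s.lx (i + 1) (j + 1)) :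
    x (X (a i j)) - ζ • X (x (a i j)) - ζ • (g (G (a i j)) - a i j) =
      ((1 - ζ) * (γt * γt') + ζ) • a i j +
      (s.μG i j * s.μg (i + 1) (j + 1) * ((ζ - 1) * (γs * γs') - ζ)) • a (i + 1 + 1) (j + 1 + 1) +
      (s.lX i j * s.lx i (j + 1) - ζ * s.lx i j * s.lX i (j + 1)) • a i (j + 1 + 1) := by
  have hζ0 : ζ ≠ 0 := hζ.ne_zero (NeZero.ne n)
  have hi := rootPow_ne_zero hζ0 i
  have hj := rootPow_ne_zero hζ0 j
  simp only [hg, hG, hx i j, hx (i + 1), hx i (j + 1), hX i j, hX (i + 1), hX i (j + 1), map_smul,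
    map_add, map_sub, rootPow_inv, rootPow_add_one hζ.pow_eq_one, mul_inv]
  generalize rootPow ζ i = u at *
  generalize rootPow ζ j = v at *
  match_scalars
  · field_simp
    ring
  · field_simp
    ring
  · field_simp
    ring
  · field_simp
    linear_combination (γs * γs') * hc
  · field_simp
    linear_combination γs' * hxG - ζ ^ 2 * u ^ 2 * γs * hgX
  · ring

theorem ArrowScalars.CompatibleAt.μg_ne_zero {s : ArrowScalars k n} {ζ : k} {i j : ZMod n}
    (h : s.CompatibleAt ζ i j) : s.μg i j ≠ 0 := by
  have := Finset.prod_ne_zero_iff.1 (h.prod_μg ▸ one_ne_zero) 0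
    (Finset.mem_range.2 (NeZero.pos n))
  simpa using this

theorem ArrowScalars.CompatibleAt.μG_ne_zero {s : ArrowScalars k n} {ζ : k} {i j : ZMod n}
    (h : s.CompatibleAt ζ i j) : s.μG i j ≠ 0 := by
  have := Finset.prod_ne_zero_iff.1 (h.prod_μG ▸ one_ne_zero) 0
    (Finset.mem_range.2 (NeZero.pos n))
  simpa using this

omit [NeZero n] in
-- This separates `n ≥ 3` from `n = 2`: here the three positions left over in `sub_apply` are
-- distinct.
theorem ZMod.add_one_add_one_ne (h : 3 ≤ n) (i : ZMod n) : i + 1 + 1 ≠ i := by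
  intro h0
  have h1 : ((2 : ℕ) : ZMod n) = 0 := by
    push_cast
    linear_combination h0
  exact absurd (Nat.le_of_dvd (by omega) ((ZMod.natCast_eq_zero_iff 2 n).1 h1)) (by omega)

theorem ZMod.add_one_add_one_eq (h : n = 2) (i : ZMod n) : i + 1 + 1 = i := by
  subst h
  revert i
  decide

theorem IsPrimitiveRoot.eq_neg_one_of_eq_two {ζ : k} (hζ : IsPrimitiveRoot ζ n) (h : n = 2) :
    ζ = -1 := by
  subst h
  exact hζ.eq_neg_one_of_two_right

/-- The right side is the shape in which the condition on `γ` appears as a coefficient in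
`sub_apply`. -/
theorem mul_one_sub_inv_eq_one_iff {ζ c : k} (hζ : ζ ≠ 0) :
    c * (1 - ζ⁻¹) = 1 ↔ (1 - ζ) * c + ζ = 0 := by
  constructor
  · intro h
    field_simp at h
    linear_combination -h
  · intro h
    field_simp
    linear_combination -h

/-- A family of vectors indexed by the arrows of a rotation-stable set `P`, and zero off `P`, with
coordinate functionals. -/
structure IsOrbitFamily (a : ZMod n → ZMod n → A) (P : ZMod n → ZMod n → Prop) (k : Type*)
    [Field k] [Module k A] : Prop where
  stable : ∀ i j, P i j ↔ P (i + 1) (j + 1)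
  zero : ∀ i j, ¬ P i j → a i j = 0
  dual : ∀ i j, P i j → ∃ c : A →ₗ[k] k, ∀ i' j', c (a i' j') = if i' = i ∧ j' = j then 1 else 0

/-- The Taft-type formulas for four operators on a family of vectors. -/
structure OrbitFormulas (a : ZMod n → ZMod n → A) (P : ZMod n → ZMod n → Prop)
    (ζ γs γt γs' γt' : k) (s : ArrowScalars k n) (g x G X : Module.End k A) : Prop where
  g : ∀ i j, P i j → g (a i j) = s.μg i j • a (i + 1) (j + 1)
  G : ∀ i j, P i j → G (a i j) = s.μG i j • a (i + 1) (j + 1)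
  x : ∀ i j, P i j → x (a i j) = (γt * rootPow ζ j) • a i j
    - (γs * rootPow ζ (i + 1) * s.μg i j) • a (i + 1) (j + 1) + s.lx i j • a i (j + 1)
  X : ∀ i j, P i j → X (a i j) = (γt' * (rootPow ζ j)⁻¹) • a i j
    - (γs' * (rootPow ζ (i + 1))⁻¹ * s.μG i j) • a (i + 1) (j + 1) + s.lX i j • a i (j + 1)

/-- The conditions on the scalars under which the Taft-type formulas satisfy the relations. -/
structure OrbitConditions (P : ZMod n → ZMod n → Prop) (ζ γs γt γs' γt' : k)
    (s : ArrowScalars k n) : Prop where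
  compatible : ∀ i j, P i j → s.CompatibleAt ζ i j
  x_pow : ∀ i j, P i j → γs ^ n = γt ^ n + ∏ l ∈ Finset.range n, s.lx i (j + l)
  X_pow : ∀ i j, P i j → γs' ^ n = γt' ^ n + ∏ l ∈ Finset.range n, s.lX i (j + l)
  γ_ge_three : 3 ≤ n → ∀ i j, P i j → γs * γs' * (1 - ζ⁻¹) = 1 ∧ γt * γt' * (1 - ζ⁻¹) = 1
  l_comm : 3 ≤ n → ∀ i j, P i j → s.lX i j * s.lx i (j + 1) - ζ * s.lx i j * s.lX i (j + 1) = 0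
  γ_two : n = 2 → ∀ i j, P i j →
    2 * (γt * γt') - 2 * (s.μG i j * s.μg (i + 1) (j + 1)) * (γs * γs')
      + s.lX i j * s.lx i (j + 1) + s.lx i j * s.lX i (j + 1)
      = 1 - s.μG i j * s.μg (i + 1) (j + 1)

open Classical in
/-- The scalars with `λ` replaced by zero off `P`. -/
noncomputable def ArrowScalars.truncate (s : ArrowScalars k n) (P : ZMod n → ZMod n → Prop) :
    ArrowScalars k n where
  μg := s.μg
  μG := s.μG
  lx i j := if P i j then s.lx i j else 0
  lX i j := if P i j then s.lX i j else 0

omit [NeZero n] in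
-- Compatibility at `(i, j)` involves `λ` only at `(i, j)` and `(i + 1, j + 1)`, neither of which is
-- truncated.
theorem ArrowScalars.compatibleAt_truncate {s : ArrowScalars k n} {P : ZMod n → ZMod n → Prop}
    {ζ : k} {i j : ZMod n} (h : P i j) (h' : P (i + 1) (j + 1)) :
    (s.truncate P).CompatibleAt ζ i j ↔ s.CompatibleAt ζ i j := by
  have e1 : (s.truncate P).lx i j = s.lx i j := if_pos h
  have e2 : (s.truncate P).lX i j = s.lX i j := if_pos h
  have e3 : (s.truncate P).lx (i + 1) (j + 1) = s.lx (i + 1) (j + 1) := if_pos h'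
  have e4 : (s.truncate P).lX (i + 1) (j + 1) = s.lX (i + 1) (j + 1) := if_pos h'
  constructor
  · rintro ⟨h1, h2, h3, h4, h5, h6, h7⟩
    rw [e1, e3] at h4 h7
    rw [e2, e4] at h5 h6
    exact ⟨h1, h2, h3, h4, h5, h6, h7⟩
  · rintro ⟨h1, h2, h3, h4, h5, h6, h7⟩
    rw [← e1, ← e3] at h4 h7
    rw [← e2, ← e4] at h5 h6
    exact ⟨h1, h2, h3, h4, h5, h6, h7⟩

/-- If row `i` lies in `P`, nothing was truncated. Otherwise some `(i, j')` is missing, and the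
cyclic product contains the factor at `j' - 1`, which is zero on both sides. -/
theorem prod_truncate {P : ZMod n → ZMod n → Prop} {l l' : ZMod n → ZMod n → k}
    (hl : ∀ i j, ¬ P i (j + 1) → l i j = 0) (hl' : ∀ i j, ¬ P i (j + 1) → l' i j = 0)
    (h : ∀ i j, P i j → l' i j = l i j) (i j : ZMod n) :
    ∏ m ∈ Finset.range n, l' i (j + m) = ∏ m ∈ Finset.range n, l i (j + m) := by
  by_cases hP : ∀ j, P i j
  · exact Finset.prod_congr rfl fun m _ => h _ _ (hP _)
  · push Not at hP
    obtain ⟨j', hj'⟩ := hP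
    have hm : (j' - 1 - j).val ∈ Finset.range n := Finset.mem_range.2 (ZMod.val_lt _)
    have e : j + ((j' - 1 - j).val : ZMod n) = j' - 1 := by rw [ZMod.natCast_zmod_val]; ring
    rw [Finset.prod_eq_zero hm (by rw [e]; exact hl' _ _ (by rwa [sub_add_cancel])),
      Finset.prod_eq_zero hm (by rw [e]; exact hl _ _ (by rwa [sub_add_cancel]))]

/-- The Taft-type formulas satisfy the relations of `D(T(n))` on the family if and only if the
scalars satisfy the conditions. -/
theorem orbit_relations_iff (hn : 2 ≤ n) {a : ZMod n → ZMod n → A} {P : ZMod n → ZMod n → Prop}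
    {ζ γs γt γs' γt' : k} {s : ArrowScalars k n} {g x G X : Module.End k A}
    (hζ : IsPrimitiveRoot ζ n) (ha : IsOrbitFamily a P k)
    (hf : OrbitFormulas a P ζ γs γt γs' γt' s g x G X)
    (hl : ∀ i j, ¬ P i (j + 1) → s.lx i j = 0 ∧ s.lX i j = 0) :
    (∀ i j, P i j → DRelationsAt n ζ g x G X (a i j)) ↔
      OrbitConditions P ζ γs γt γs' γt' s := by
  have hζ0 : ζ ≠ 0 := hζ.ne_zero (NeZero.ne n)
  have hζ1 : ζ⁻¹ ^ n = 1 := hζ.inv.pow_eq_one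
  -- the formulas hold at all indices once the scalars are truncated
  obtain ⟨t, ht⟩ : ∃ t, t = s.truncate P := ⟨_, rfl⟩
  have hμg : t.μg = s.μg := by rw [ht]; rfl
  have hμG : t.μG = s.μG := by rw [ht]; rfl
  have htx : ∀ i j, P i j → t.lx i j = s.lx i j := fun i j h => by rw [ht]; exact if_pos h
  have htX : ∀ i j, P i j → t.lX i j = s.lX i j := fun i j h => by rw [ht]; exact if_pos h
  have htx0 : ∀ i j, ¬ P i j → t.lx i j = 0 := fun i j h => by rw [ht]; exact if_neg h
  have htX0 : ∀ i j, ¬ P i j → t.lX i j = 0 := fun i j h => by rw [ht]; exact if_neg h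
  have htl : ∀ i j, ¬ P i (j + 1) → t.lx i j = 0 ∧ t.lX i j = 0 := fun i j h => by
    by_cases h' : P i j
    · rw [htx i j h', htX i j h']; exact hl i j h
    · exact ⟨htx0 i j h', htX0 i j h'⟩
  have hcompat : ∀ i j, P i j → (t.CompatibleAt ζ i j ↔ s.CompatibleAt ζ i j) := fun i j h => by
    rw [ht]; exact ArrowScalars.compatibleAt_truncate h ((ha.stable i j).1 h)
  have hprod := prod_truncate (fun i j h => (hl i j h).1) (fun i j h => (htl i j h).1) htx
  have hprod' := prod_truncate (fun i j h => (hl i j h).2) (fun i j h => (htl i j h).2) htX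
  -- A quadratic term is unchanged by truncation: either its second index lies in `P`, or its first
  -- factor already vanishes.
  have hlc : ∀ i j, P i j → t.lX i j * t.lx i (j + 1) = s.lX i j * s.lx i (j + 1) ∧
      t.lx i j * t.lX i (j + 1) = s.lx i j * s.lX i (j + 1) := fun i j h => by
    by_cases h' : P i (j + 1)
    · rw [htx _ _ h, htX _ _ h, htx _ _ h', htX _ _ h']; exact ⟨rfl, rfl⟩
    · rw [(hl i j h').1, (hl i j h').2, (htl i j h').1, (htl i j h').2]; simp
  have z' : ∀ i j, ¬ P i j → a (i + 1) (j + 1) = 0 := fun i j h =>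
    ha.zero _ _ (fun h' => h ((ha.stable i j).2 h'))
  have fg : ∀ i j, g (a i j) = t.μg i j • a (i + 1) (j + 1) := fun i j => by
    by_cases h : P i j
    · rw [hμg]; exact hf.g i j h
    · rw [ha.zero i j h, z' i j h, map_zero, smul_zero]
  have fG : ∀ i j, G (a i j) = t.μG i j • a (i + 1) (j + 1) := fun i j => by
    by_cases h : P i j
    · rw [hμG]; exact hf.G i j h
    · rw [ha.zero i j h, z' i j h, map_zero, smul_zero]
  have fx : IsTaftOperator a ζ γs γt t.μg t.lx x := fun i j => by
    by_cases h : P i j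
    · rw [hμg, htx i j h]; exact hf.x i j h
    · rw [ha.zero i j h, z' i j h, htx0 i j h]; simp
  have fX : IsTaftOperator a ζ⁻¹ γs' γt' t.μG t.lX X := fun i j => by
    by_cases h : P i j
    · rw [hμG, htX i j h, rootPow_inv, rootPow_inv]; exact hf.X i j h
    · rw [ha.zero i j h, z' i j h, htX0 i j h]; simp
  -- extraction of coefficients
  have coeff : ∀ (c : k) (i j : ZMod n), P i j → c • a i j = 0 → c = 0 := fun c i j h h0 => by
    obtain ⟨f, hf⟩ := ha.dual i j h
    simpa [hf] using congr_arg f h0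
  have st := fun i j (h : P i j) => (ha.stable i j).1 h
  have sn := fun i j (h : ¬ P i j) (h' : P (i + 1) (j + 1)) => h ((ha.stable i j).2 h')
  have hper : ∀ i j : ZMod n, a (i + (n : ZMod n)) (j + (n : ZMod n)) = a i j := fun i j => by simp
  have powx : (∀ i j, P i j → t.CompatibleAt ζ i j) → ∀ i j, P i j → (x ^ n) (a i j) =
      (γt ^ n - γs ^ n + ∏ m ∈ Finset.range n, t.lx i (j + m)) • a i j := fun h i j hP => by
    rw [fx.pow_apply hζ, (h i j hP).prod_μg, mul_one]
    intro i j
    by_cases hP : P i j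
    · exact (h i j hP).xg
    · rw [htx0 _ _ hP, htx0 _ _ (sn _ _ hP), mul_zero, mul_zero]
  have powX : (∀ i j, P i j → t.CompatibleAt ζ i j) → ∀ i j, P i j → (X ^ n) (a i j) =
      (γt' ^ n - γs' ^ n + ∏ m ∈ Finset.range n, t.lX i (j + m)) • a i j := fun h i j hP => by
    rw [fX.pow_apply hζ.inv, (h i j hP).prod_μG, mul_one]
    intro i j
    by_cases hP : P i j
    · rw [mul_assoc, (h i j hP).GX, mul_assoc, inv_mul_cancel_left₀ hζ0]
    · rw [htX0 _ _ hP, htX0 _ _ (sn _ _ hP), mul_zero, mul_zero]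
  -- In the pairs `x, g` and `X, G` the rotation weights agree, so the commutation hypothesis is
  -- `rfl`. The mixed pairs need `comm`, which must be extracted first.
  have eg : ∀ i j, x (g (a i j)) - ζ • g (x (a i j)) = _ := fun i j =>
    fx.comm_apply hζ.pow_eq_one fg (i := i) (j := j) rfl
  have eG : ∀ i j, X (G (a i j)) - ζ⁻¹ • G (X (a i j)) = _ := fun i j =>
    fX.comm_apply hζ1 fG (i := i) (j := j) rfl
  have hsub : ∀ i j, t.CompatibleAt ζ i j →
      x (X (a i j)) - ζ • X (x (a i j)) - ζ • (g (G (a i j)) - a i j) = _ := fun i j h =>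
    fx.sub_apply hζ fg fG fX h.comm h.gX h.xG
  constructor
  · intro h
    have comm : ∀ i j, P i j →
        t.μG i j * t.μg (i + 1) (j + 1) = t.μg i j * t.μG (i + 1) (j + 1) := fun i j hP => by
      have := (h i j hP).gG
      rw [fG, fg, map_smul, map_smul, fg, fG, smul_smul, smul_smul, ← sub_eq_zero, ← sub_smul] at this
      exact sub_eq_zero.1 (coeff _ _ _ (st _ _ (st _ _ hP)) this)
    have tcompat : ∀ i j, P i j → t.CompatibleAt ζ i j := by
      intro i j hP
      have r := h i j hP
      -- The coefficient at `(i + 1, j + 2)` can be read off only if that vector is nonzero.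
      -- Otherwise `zl` makes the linear conditions on `λ` read `0 = 0`.
      have ext : ∀ c : k, c • a (i + 1) (j + 1 + 1) = 0 → P i (j + 1) → c = 0 := fun c hc hP' =>
        coeff _ _ _ (st _ _ hP') hc
      have zl : ¬ P i (j + 1) → t.lx i j = 0 ∧ t.lX i j = 0 ∧ t.lx (i + 1) (j + 1) = 0 ∧
          t.lX (i + 1) (j + 1) = 0 := fun hP' =>
        ⟨(htl i j hP').1, (htl i j hP').2, (htl _ _ (sn _ _ hP')).1, (htl _ _ (sn _ _ hP')).2⟩
      refine ⟨?_, ?_, comm i j hP, ?_, ?_, ?_, ?_⟩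
      · have := r.g_pow
        rw [iterate_pow_apply fg, hper, ← sub_eq_zero] at this
        refine sub_eq_zero.1 (coeff _ i j hP ?_)
        rw [sub_smul, one_smul, this]
      · have := r.G_pow
        rw [iterate_pow_apply fG, hper, ← sub_eq_zero] at this
        refine sub_eq_zero.1 (coeff _ i j hP ?_)
        rw [sub_smul, one_smul, this]
      · by_cases hP' : P i (j + 1)
        · have e := eg i j
          rw [r.xg, sub_self] at e
          linear_combination -ext _ e.symm hP'
        · obtain ⟨h1, h2, h3, h4⟩ := zl hP'; rw [h1, h3]; ring
      · by_cases hP' : P i (j + 1)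
        · have e := eG i j
          rw [r.GX, inv_smul_smul₀ hζ0, sub_self] at e
          have := ext _ e.symm hP'
          field_simp at this
          linear_combination -this
        · obtain ⟨h1, h2, h3, h4⟩ := zl hP'; rw [h2, h4]; ring
      · by_cases hP' : P i (j + 1)
        · have e := fX.comm_apply hζ1 fg (comm i j hP).symm
          rw [r.gX, inv_smul_smul₀ hζ0, sub_self] at e
          have := ext _ e.symm hP'
          field_simp at this
          linear_combination -this
        · obtain ⟨h1, h2, h3, h4⟩ := zl hP'; rw [h2, h4]; ring
      · by_cases hP' : P i (j + 1)
        · have e := fx.comm_apply hζ.pow_eq_one fG (comm i j hP)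
          rw [r.xG, sub_self] at e
          linear_combination -ext _ e.symm hP'
        · obtain ⟨h1, h2, h3, h4⟩ := zl hP'; rw [h1, h3]; ring
    have c0 : ∀ i j, P i j → t.μG i j * t.μg (i + 1) (j + 1) ≠ 0 :=
      fun i j hP => mul_ne_zero (tcompat i j hP).μG_ne_zero (tcompat _ _ (st i j hP)).μg_ne_zero
    have key : ∀ i j, P i j → (0 : A) = _ := fun i j hP =>
      (sub_eq_zero.2 (h i j hP).xX).symm.trans (hsub i j (tcompat i j hP))
    -- For `n ≥ 3` the three coefficients of `sub_apply` are extracted by three coordinate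
    -- functionals. If `(i, j + 2)` is absent, the last one vanishes by truncation.
    have scal : ∀ i j, P i j → 3 ≤ n → γs * γs' * (1 - ζ⁻¹) = 1 ∧ γt * γt' * (1 - ζ⁻¹) = 1 ∧
        s.lX i j * s.lx i (j + 1) - ζ * s.lx i j * s.lX i (j + 1) = 0 := by
      intro i j hP h3
      have ne := ZMod.add_one_add_one_ne h3
      have e := (key i j hP).symm
      obtain ⟨f₁, hf₁⟩ := ha.dual i j hP
      obtain ⟨f₂, hf₂⟩ := ha.dual _ _ (st _ _ (st _ _ hP))
      have e₁ := congr_arg f₁ e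
      have e₂ := congr_arg f₂ e
      simp only [map_add, map_smul, map_zero, hf₁, ne, and_self, if_true, and_false, if_false,
        smul_eq_mul, mul_one, mul_zero, add_zero] at e₁
      simp only [map_add, map_smul, map_zero, hf₂, (ne _).symm, and_self, if_true, and_true,
        if_false, smul_eq_mul, mul_one, mul_zero, add_zero, zero_add] at e₂
      have e₂' := (mul_eq_zero.1 e₂).resolve_left (c0 i j hP)
      refine ⟨(mul_one_sub_inv_eq_one_iff hζ0).2 (by linear_combination -e₂'),
        (mul_one_sub_inv_eq_one_iff hζ0).2 e₁, ?_⟩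
      rw [← (hlc i j hP).1, mul_assoc, ← (hlc i j hP).2, ← mul_assoc]
      by_cases hP' : P i (j + 1 + 1)
      · obtain ⟨f₃, hf₃⟩ := ha.dual _ _ hP'
        have e₃ := congr_arg f₃ e
        simpa only [map_add, map_smul, map_zero, hf₃, (ne _).symm, ne, and_self, if_true, and_false,
          and_true, if_false, smul_eq_mul, mul_one, mul_zero, add_zero, zero_add] using e₃
      · rw [(htl _ _ hP').1, (htl _ _ hP').2]; ring
    refine ⟨fun i j hP => (hcompat i j hP).1 (tcompat i j hP), fun i j hP => ?_, fun i j hP => ?_,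
      fun h3 i j hP => ⟨(scal i j hP h3).1, (scal i j hP h3).2.1⟩,
      fun h3 i j hP => (scal i j hP h3).2.2, fun h2 i j hP => ?_⟩
    · have e := (h i j hP).x_pow
      rw [powx tcompat i j hP] at e
      rw [← hprod]
      linear_combination -coeff _ _ _ hP e
    · have e := (h i j hP).X_pow
      rw [powX tcompat i j hP] at e
      rw [← hprod']
      linear_combination -coeff _ _ _ hP e
    · have e := (key i j hP).symm
      -- For `n = 2` all three vectors in `key` are `a i j` and `ζ = -1`, so only the sum of the
      -- coefficients is known to vanish.
      have two := ZMod.add_one_add_one_eq h2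
      rw [two, two, ← add_smul, ← add_smul, hζ.eq_neg_one_of_eq_two h2] at e
      have e' := coeff _ _ _ hP e
      obtain ⟨l1, l2⟩ := hlc i j hP
      rw [← l1, ← l2, ← hμg, ← hμG]
      linear_combination e'
  · intro h i j hP
    -- `X` is a Taft operator for `ζ⁻¹`, so its relations come out of `comm_apply` in inverted form.
    have inv_eq : ∀ u v : A, v - ζ⁻¹ • u = 0 → u = ζ • v := fun u v h => by
      rw [sub_eq_zero.1 h, smul_inv_smul₀ hζ0]
    have tcompat : ∀ i j, P i j → t.CompatibleAt ζ i j := fun i j hP =>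
      (hcompat i j hP).2 (h.compatible i j hP)
    have tc := tcompat i j hP
    refine ⟨?_, ?_, ?_, ?_, ?_, ?_, ?_, ?_, ?_, ?_⟩
    · rw [← sub_eq_zero, eg, ← tc.xg, sub_self, zero_smul]
    · refine inv_eq _ _ ?_
      rw [eG, mul_assoc, tc.GX, mul_assoc, inv_mul_cancel_left₀ hζ0, sub_self, zero_smul]
    · refine inv_eq _ _ ?_
      rw [fX.comm_apply hζ1 fg tc.comm.symm, mul_assoc, tc.gX, mul_assoc,
        inv_mul_cancel_left₀ hζ0, sub_self, zero_smul]
    · rw [← sub_eq_zero, fx.comm_apply hζ.pow_eq_one fG tc.comm, ← tc.xG, sub_self, zero_smul]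
    · rw [fG, fg, map_smul, map_smul, fg, fG, smul_smul, smul_smul, tc.comm]
    · rw [iterate_pow_apply fg, hper, tc.prod_μg, one_smul]
    · rw [iterate_pow_apply fG, hper, tc.prod_μG, one_smul]
    · rw [powx tcompat i j hP, hprod, h.x_pow i j hP, sub_add_eq_sub_sub, sub_self, zero_sub,
        neg_add_cancel, zero_smul]
    · rw [powX tcompat i j hP, hprod', h.X_pow i j hP, sub_add_eq_sub_sub, sub_self, zero_sub,
        neg_add_cancel, zero_smul]
    · rw [← sub_eq_zero, hsub i j tc]
      obtain ⟨l1, l2⟩ := hlc i j hP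
      rcases hn.eq_or_lt with h2 | h3
      · have two := ZMod.add_one_add_one_eq h2.symm
        have e := h.γ_two h2.symm i j hP
        rw [← l1, ← l2, ← hμg, ← hμG] at e
        rw [two, two, ← add_smul, ← add_smul, hζ.eq_neg_one_of_eq_two h2.symm]
        convert zero_smul k (a i j) using 2
        linear_combination e
      · obtain ⟨e1, e2⟩ := h.γ_ge_three h3 i j hP
        have e3 := h.l_comm h3 i j hP
        rw [mul_one_sub_inv_eq_one_iff hζ0] at e1 e2
        rw [← l1, mul_assoc, ← l2, ← mul_assoc] at e3
        rw [e2, e3, show (ζ - 1) * (γs * γs') - ζ = 0 by linear_combination -e1, mul_zero]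
        simp

end OrbitRelations

/-! ### Taft-type actions on path algebras -/

section PathAlgebraActions

namespace PathAlgebra

variable {k V : Type*} [Field k] [Fintype V] [Quiver V]

/-- The values on the trivial paths and the arrows of the operators of a Taft-type action. -/
structure HasTaftValues (τ : Equiv.Perm V) (w w' : V → k)
    (f f' d d' : ∀ {u v : V}, (u ⟶ v) → PathAlgebra k V)
    (g x G X : Module.End k (PathAlgebra k V)) : Prop where
  g_vertex : ∀ v, g (vertex k v) = vertex k (τ v)
  G_vertex : ∀ v, G (vertex k v) = vertex k (τ v)
  x_vertex : ∀ v, x (vertex k v) = w v • vertex k v - w (τ v) • vertex k (τ v)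
  X_vertex : ∀ v, X (vertex k v) = w' v • vertex k v - w' (τ v) • vertex k (τ v)
  g_arrow : ∀ {u v : V} (α : u ⟶ v), g (arrow k α) = f α
  G_arrow : ∀ {u v : V} (α : u ⟶ v), G (arrow k α) = f' α
  x_arrow : ∀ {u v : V} (α : u ⟶ v), x (arrow k α) = w v • arrow k α - w (τ u) • f α + d α
  X_arrow : ∀ {u v : V} (α : u ⟶ v), X (arrow k α) = w' v • arrow k α - w' (τ u) • f' α + d' α

/-- The elements that are combinations of paths of length at most one from `u` to `v`. -/
def Joins (u v : V) (z : PathAlgebra k V) : Prop :=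
  vertex k u * z = z ∧ z * vertex k v = z ∧ z ∈ filtration k V 1

theorem Joins.zero (u v : V) : Joins u v (0 : PathAlgebra k V) :=
  ⟨mul_zero _, zero_mul _, Submodule.zero_mem _⟩

theorem Joins.smul {u v : V} {z : PathAlgebra k V} (h : Joins u v z) (c : k) :
    Joins u v (c • z) :=
  ⟨by rw [mul_smul_comm, h.1], by rw [smul_mul_assoc, h.2.1], Submodule.smul_mem _ _ h.2.2⟩

theorem joins_vertex (v : V) : Joins v v (vertex k v) :=
  ⟨vertex_mul_self v, vertex_mul_self v, vertex_mem_filtration v 1⟩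

theorem joins_arrow {u v : V} (α : u ⟶ v) : Joins u v (arrow k α) :=
  ⟨vertex_mul_arrow α, arrow_mul_vertex α, arrow_mem_filtration α⟩

/-- Existence of Taft-type actions: prescribed values on the trivial paths and the arrows extend to
a filtered action as soon as the relations hold on these. -/
theorem exists_hopfAction {n : ℕ} [NeZero n] {ζ : k} (hζ : IsPrimitiveRoot ζ n)
    (τ : Equiv.Perm V) (w w' : V → k) (f f' d d' : ∀ {u v : V}, (u ⟶ v) → PathAlgebra k V)
    (hf : ∀ {u v : V} (α : u ⟶ v), Joins (τ u) (τ v) (f α))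
    (hf' : ∀ {u v : V} (α : u ⟶ v), Joins (τ u) (τ v) (f' α))
    (hd : ∀ {u v : V} (α : u ⟶ v), Joins u (τ v) (d α))
    (hd' : ∀ {u v : V} (α : u ⟶ v), Joins u (τ v) (d' α))
    (hrel : ∀ {g x G X : Module.End k (PathAlgebra k V)},
      HasTaftValues τ w w' f f' d d' g x G X →
        ∀ z ∈ generators k V, DRelationsAt n ζ g x G X z) :
    ∃ φ : HopfAction k (DTaft hζ) (PathAlgebra k V),
      HasTaftValues τ w w' f f' d d' (φ.act (DTaft.g hζ)) (φ.act (DTaft.x hζ))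
        (φ.act (DTaft.G hζ)) (φ.act (DTaft.X hζ)) ∧ Filtered φ := by
  obtain ⟨g, hgv, hga⟩ := exists_twist τ f (fun α => (hf α).1) (fun α => (hf α).2.1)
  obtain ⟨G, hGv, hGa⟩ := exists_twist τ f' (fun α => (hf' α).1) (fun α => (hf' α).2.1)
  obtain ⟨x, hx, hxv, hxa⟩ := exists_skewDerivation τ hgv w d (fun α => (hd α).1)
    (fun α => (hd α).2.1)
  obtain ⟨X, hX, hXv, hXa⟩ := exists_skewDerivation τ hGv w' d' (fun α => (hd' α).1)
    (fun α => (hd' α).2.1)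
  have hval : HasTaftValues τ w w' f f' d d' g.toLinearMap x G.toLinearMap X :=
    ⟨hgv, hGv, hxv, hXv, hga, hGa, fun α => by rw [hxa, hga], fun α => by rw [hXa, hGa]⟩
  obtain ⟨φ, hφg, hφx, hφG, hφX⟩ := HopfAction.exists_of_generators (hζ := hζ) adjoin_generators
    hx hX (hrel hval)
  refine ⟨φ, by rwa [hφg, hφx, hφG, hφX], filtered_of_generators φ fun i {u v} p => ?_⟩
  have mg : ∀ {u v : V} (α : u ⟶ v), g (arrow k α) ∈ filtration k V 1 := fun α => by
    rw [hga]; exact (hf α).2.2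
  have mG : ∀ {u v : V} (α : u ⟶ v), G (arrow k α) ∈ filtration k V 1 := fun α => by
    rw [hGa]; exact (hf' α).2.2
  cases i
  · rw [show φ.act (DTaft.of hζ .g) = _ from hφg]
    exact algHom_mem_filtration (fun v => by rw [hgv]; exact vertex_mem_filtration _ _) mg p
  · rw [show φ.act (DTaft.of hζ .x) = _ from hφx]
    refine skewDerivation_mem_filtration hx mg (fun v => ?_) (fun α => ?_) p
    · rw [hxv]
      exact Submodule.sub_mem _ (Submodule.smul_mem _ _ (vertex_mem_filtration _ _))
        (Submodule.smul_mem _ _ (vertex_mem_filtration _ _))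
    · rw [hxa]
      exact Submodule.add_mem _ (Submodule.sub_mem _
        (Submodule.smul_mem _ _ (arrow_mem_filtration α)) (Submodule.smul_mem _ _ (mg α)))
        (hd α).2.2
  · rw [show φ.act (DTaft.of hζ .G) = _ from hφG]
    exact algHom_mem_filtration (fun v => by rw [hGv]; exact vertex_mem_filtration _ _) mG p
  · rw [show φ.act (DTaft.of hζ .X) = _ from hφX]
    refine skewDerivation_mem_filtration hX mG (fun v => ?_) (fun α => ?_) p
    · rw [hXv]
      exact Submodule.sub_mem _ (Submodule.smul_mem _ _ (vertex_mem_filtration _ _))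
        (Submodule.smul_mem _ _ (vertex_mem_filtration _ _))
    · rw [hXa]
      exact Submodule.add_mem _ (Submodule.sub_mem _
        (Submodule.smul_mem _ _ (arrow_mem_filtration α)) (Submodule.smul_mem _ _ (mG α)))
        (hd' α).2.2

end PathAlgebra

/-! ### Type A: subquivers of the complete quiver -/

section TypeA

namespace CompleteQuiver

open PathAlgebra

variable {k : Type*} [Field k] {n : ℕ} {Q : WideSubquiver (CompleteQuiver n)}

/-- The label of a vertex. -/
def label (u : Q) : ZMod n := u

variable (Q) in
/-- The rotation of the vertices. -/
def rotation : Equiv.Perm Q := show Equiv.Perm (ZMod n) from Equiv.addRight 1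

theorem HasArrow.ne {i j : ZMod n} (h : HasArrow Q i j) : i ≠ j := h.choose.down

/-- The arrow from `i` to `j`. -/
noncomputable def HasArrow.hom {i j : ZMod n} (h : HasArrow Q i j) :
    (show Q from i) ⟶ (show Q from j) :=
  ⟨h.choose, h.choose_spec⟩

theorem hasArrow_of_hom {u v : Q} (α : u ⟶ v) : HasArrow Q (label u) (label v) := ⟨α.1, α.2⟩

variable [NeZero n]

theorem a_self (i : ZMod n) : a k Q i i = PathAlgebra.vertex k (V := Q) i := if_pos rfl

theorem a_mul_self (i : ZMod n) : a k Q i i * a k Q i i = a k Q i i := by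
  rw [a_self]
  exact vertex_mul_self _

theorem sum_a : ∑ i : ZMod n, a k Q i i = 1 := by
  simp only [a_self]
  exact sum_vertex (k := k) (V := Q)

theorem a_of_hasArrow {i j : ZMod n} (h : HasArrow Q i j) : a k Q i j = arrow k h.hom := by
  rw [a, if_neg h.ne, dif_pos h]
  rfl

theorem a_of_not_hasPath {i j : ZMod n} (h : ¬ HasPath Q i j) : a k Q i j = 0 := by
  rw [HasPath, not_or] at h
  rw [a, if_neg h.1, dif_neg h.2]

theorem arrow_eq_a {u v : Q} (α : u ⟶ v) : arrow k α = a k Q (label u) (label v) := by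
  rw [a_of_hasArrow (hasArrow_of_hom α)]
  exact congr_arg (arrow k) (Subtype.ext (PLift.down_injective (Subsingleton.elim _ _)))

theorem joins_a (i j : ZMod n) : Joins (V := Q) i j (a k Q i j) := by
  by_cases h : HasPath Q i j
  · rcases h with rfl | h
    · rw [a_self]; exact joins_vertex _
    · rw [a_of_hasArrow h]; exact joins_arrow _
  · rw [a_of_not_hasPath h]; exact Joins.zero _ _

/-- Since `K_n` has no loops, the trivial paths can fill the diagonal, and a single family contains
all generators. -/
theorem mem_generators {z : PathAlgebra k Q} (h : z ∈ generators k Q) :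
    ∃ i j, HasPath Q i j ∧ z = a k Q i j := by
  rcases h with ⟨v, rfl⟩ | ⟨u, v, α, rfl⟩
  · exact ⟨v, v, .inl rfl, (a_self _).symm⟩
  · exact ⟨u, v, .inr (hasArrow_of_hom α), arrow_eq_a α⟩

theorem isOrbitFamily (hQ : Stable Q) : IsOrbitFamily (a k Q) (HasPath Q) k where
  stable i j := or_congr (add_left_inj 1).symm (hQ i j)
  zero _ _ := a_of_not_hasPath
  dual i j hij := by
    let inst : DecidableEq Q := inferInstanceAs (DecidableEq (ZMod n))
    obtain ⟨F, hv, ha⟩ := exists_matrix_representation k Q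
    -- There is at most one arrow for each ordered pair of vertices and none on the diagonal, so
    -- distinct nonzero `a i j` map to distinct matrix units and a matrix entry serves as coordinate
    -- functional.
    refine ⟨Matrix.entryLinearMap k k (m := Q) (n := Q) i j ∘ₗ F.toLinearMap, fun i' j' => ?_⟩
    have hF : HasPath Q i' j' → F (a k Q i' j') = Matrix.single (m := Q) (n := Q) i' j' 1 := by
      rintro (rfl | h)
      · rw [a_self]; exact hv _
      · rw [a_of_hasArrow h]; exact ha _
    by_cases h : HasPath Q i' j'
    · change F (a k Q i' j') i j = _
      rw [hF h]
      exact Matrix.single_apply ..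
    · rw [a_of_not_hasPath h, map_zero, if_neg]
      rintro ⟨rfl, rfl⟩
      exact h hij

end CompleteQuiver

open CompleteQuiver

section VertexQuiver

variable {k : Type*} [Field k] {n : ℕ}

theorem hasPath_vertexQuiver {i j : ZMod n} : HasPath (vertexQuiver n) i j ↔ i = j :=
  or_iff_left fun ⟨_, h⟩ => h

theorem stable_vertexQuiver : Stable (vertexQuiver n) := fun _ _ =>
  ⟨fun ⟨_, h⟩ => h.elim, fun ⟨_, h⟩ => h.elim⟩

/-- The quiver without arrows is the Type A case with trivial `μ` and zero `λ`; the condition for `n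
= 2` concerns arrows and is vacuous. -/
theorem typeARestrictions_vertexQuiver_iff {ζ γx γX : k} :
    TypeARestrictions (vertexQuiver n) ζ γx γX
      ⟨fun _ _ => 1, fun _ _ => 1, fun _ _ => 0, fun _ _ => 0⟩ ↔
      (3 ≤ n → γx * γX * (1 - ζ⁻¹) = 1) := by
  refine ⟨fun h => h.γ_ge_three, fun h => ⟨by simp, fun i j _ => ?_, by simp, by simp, h, ?_⟩⟩
  · constructor <;> simp
  · rintro - i j ⟨_, h'⟩
    exact h'.elim

end VertexQuiver

variable {k : Type*} [Field k] {n : ℕ} [NeZero n] {ζ : k} {hζ : IsPrimitiveRoot ζ n}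
  {Q : WideSubquiver (CompleteQuiver n)} {γx γX : k} {s : ArrowScalars k n}

theorem IsTypeAAction.orbitFormulas {φ : HopfAction k (DTaft hζ) (PathAlgebra k Q)}
    (h : IsTypeAAction Q γx γX s φ) :
    OrbitFormulas (a k Q) (HasPath Q) ζ γx γx γX γX s (φ.act (DTaft.g hζ)) (φ.act (DTaft.x hζ))
      (φ.act (DTaft.G hζ)) (φ.act (DTaft.X hζ)) where
  g i j hP := (h i j hP).1
  G i j hP := (h i j hP).2.1
  x i j hP := by rw [(h i j hP).2.2.1]; module
  X i j hP := by rw [(h i j hP).2.2.2]; module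

theorem ArrowScalars.CompatibleAt.mul_eq_one_of_two {i j : ZMod n} (h : s.CompatibleAt ζ i j)
    (h2 : n = 2) : s.μg i j * s.μg (i + 1) (j + 1) = 1 := by
  subst h2
  simpa [Finset.prod_range_succ] using h.prod_μg

theorem ZMod.add_one_eq_of_ne (h : n = 2) {i j : ZMod n} (hij : i ≠ j) : j + 1 = i := by
  subst h
  revert i j
  decide

theorem prod_shift_eq_zero {l : ZMod n → k} (j : ZMod n) {i : ZMod n} (h : l i = 0) :
    ∏ m ∈ Finset.range n, l (j + m) = 0 :=
  Finset.prod_eq_zero (Finset.mem_range.2 (ZMod.val_lt (i - j)))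
    (by rw [ZMod.natCast_zmod_val, add_sub_cancel, h])

/-- Source and target carry the same `γ`, so the power conditions ask that `∏ λ` along each row be
zero. They hold because every row passes through the diagonal, where `λ` vanishes. For `n = 2` the
same vanishing kills the quadratic `λ` terms. -/
theorem TypeARestrictions.orbitConditions (hζ : IsPrimitiveRoot ζ n)
    (h : TypeARestrictions Q ζ γx γX s) :
    OrbitConditions (HasPath Q) ζ γx γx γX γX s where
  compatible := h.compatible
  x_pow i j _ := by rw [prod_shift_eq_zero j (h.l_eq_zero i i (.inl rfl)).1, add_zero]
  X_pow i j _ := by rw [prod_shift_eq_zero j (h.l_eq_zero i i (.inl rfl)).2, add_zero]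
  γ_ge_three h3 _ _ _ := ⟨h.γ_ge_three h3, h.γ_ge_three h3⟩
  l_comm _ := h.l_comm
  γ_two h2 i j hP := by
    have hz := hζ.eq_neg_one_of_eq_two h2
    rcases hP with rfl | hP
    · rw [(h.μ_diag i).2, (h.μ_diag (i + 1)).1, (h.l_eq_zero i i (.inl rfl)).1,
        (h.l_eq_zero i i (.inl rfl)).2]
      ring
    · have hl := h.l_eq_zero i (j + 1) (.inl (ZMod.add_one_eq_of_ne h2 hP.ne).symm)
      rw [hl.1, hl.2]
      rcases h.γ_two h2 i j hP with hμ | hγ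
      · rw [← hμ, (h.compatible i j (.inr hP)).mul_eq_one_of_two h2]
        ring
      · rw [hz, inv_neg, inv_one] at hγ
        linear_combination (1 - s.μG i j * s.μg (i + 1) (j + 1)) * hγ

/-- The orbit relations do not normalise the diagonal. That part comes from the algebra structure:
idempotence of `e_i` for `μ`, and `x · 1 = X · 1 = 0` for `λ`. -/
theorem IsTypeAAction.typeARestrictions (hn : 2 ≤ n) (hQ : Stable Q)
    (hl : ∀ i j, ¬ HasPath Q i (j + 1) → s.lx i j = 0 ∧ s.lX i j = 0)
    {φ : HopfAction k (DTaft hζ) (PathAlgebra k Q)} (h : IsTypeAAction Q γx γX s φ) :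
    TypeARestrictions Q ζ γx γX s := by
  have ha := isOrbitFamily (k := k) hQ
  have hc : OrbitConditions (HasPath Q) ζ γx γx γX γX s :=
    (orbit_relations_iff hn hζ ha h.orbitFormulas hl).1 fun i j _ => φ.dRelationsAt _
  have coeff : ∀ (c : k) (i j : ZMod n), HasPath Q i j → c • a k Q i j = 0 → c = 0 :=
    fun c i j hP h0 => by
      obtain ⟨f, hf⟩ := ha.dual i j hP
      simpa [hf] using congr_arg f h0
  have diag : ∀ i : ZMod n, HasPath Q i i := fun i => .inl rfl
  have sum_shift : ∀ w : ZMod n → k,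
      ∑ i : ZMod n, w (i + 1) • a k Q (i + 1) (i + 1) = ∑ i : ZMod n, w i • a k Q i i := fun w =>
    Equiv.sum_comp (Equiv.addRight (1 : ZMod n)) (fun i => w i • a k Q i i)
  have hμ : ∀ i, s.μg i i = 1 ∧ s.μG i i = 1 := by
    intro i
    constructor
    -- Idempotence of `e_i` gives `μ ^ 2 = μ`, and `μ` is nonzero because its product along the
    -- orbit is 1.
    · have e := φ.act_g_mul (a k Q i i) (a k Q i i)
      rw [a_mul_self, (h i i (diag i)).1, smul_mul_smul_comm, a_mul_self, ← sub_eq_zero, ← sub_smul] at e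
      have e' := coeff _ _ _ (diag _) e
      have h0 := (hc.compatible i i (diag i)).μg_ne_zero
      exact mul_left_cancel₀ h0 (by linear_combination -e')
    · have e := φ.act_G_mul (a k Q i i) (a k Q i i)
      rw [a_mul_self, (h i i (diag i)).2.1, smul_mul_smul_comm, a_mul_self, ← sub_eq_zero, ← sub_smul] at e
      have e' := coeff _ _ _ (diag _) e
      have h0 := (hc.compatible i i (diag i)).μG_ne_zero
      exact mul_left_cancel₀ h0 (by linear_combination -e')
  have ext : ∀ c : ZMod n → k, ∑ i, c i • a k Q i (i + 1) = 0 → ∀ i, HasPath Q i (i + 1) →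
      c i = 0 := by
    intro c hsum i hP
    obtain ⟨f, hf⟩ := ha.dual i (i + 1) hP
    have e := congr_arg f hsum
    rw [map_sum, map_zero, Finset.sum_eq_single i] at e
    · simpa [hf] using e
    · intro j _ hj
      rw [map_smul, hf, if_neg (fun h' => hj h'.1), smul_zero]
    · simp
  have hlx : ∀ i, s.lx i i = 0 := by
    intro i
    by_cases hP : HasPath Q i (i + 1)
    · refine ext (fun i => s.lx i i) ?_ i hP
      -- Summed over all `e_i`, the `γ` terms telescope around the cycle and leave `∑ λ_{i,i}
      -- a^i_{i+1} = 0`.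
      have e := φ.act_x_one
      rw [← sum_a (k := k) (Q := Q), map_sum] at e
      simp only [(h _ _ (diag _)).2.2.1, (hμ _).1, mul_one, Finset.sum_add_distrib,
        ← Finset.smul_sum, Finset.sum_sub_distrib] at e
      rwa [sum_shift (rootPow ζ), sub_self, smul_zero, zero_add] at e
    · exact (hl i i hP).1
  have hlX : ∀ i, s.lX i i = 0 := by
    intro i
    by_cases hP : HasPath Q i (i + 1)
    · refine ext (fun i => s.lX i i) ?_ i hP
      have e := φ.act_X_one
      rw [← sum_a (k := k) (Q := Q), map_sum] at e
      simp only [(h _ _ (diag _)).2.2.2, (hμ _).2, mul_one, Finset.sum_add_distrib,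
        ← Finset.smul_sum, Finset.sum_sub_distrib] at e
      rwa [sum_shift (fun i => (rootPow ζ i)⁻¹), sub_self, smul_zero, zero_add] at e
    · exact (hl i i hP).2
  refine ⟨hμ, hc.compatible, fun i j hP => ?_, ?_, fun h3 => (hc.γ_ge_three h3 0 0 (diag 0)).1,
    fun h2 i j hA => ?_⟩
  · rcases hn.eq_or_lt with h2 | h3
    · rcases hP with rfl | hA
      · rw [hlx, hlX]; ring
      · rw [ZMod.add_one_eq_of_ne h2.symm hA.ne, hlx, hlX]; ring
    · exact hc.l_comm h3 i j hP
  · rintro i j (rfl | hP)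
    · exact ⟨hlx i, hlX i⟩
    · exact hl i j hP
  · have e := hc.γ_two h2 i j (.inr hA)
    have e1 := (hc.compatible i j (.inr hA)).mul_eq_one_of_two h2
    rw [ZMod.add_one_eq_of_ne h2 hA.ne, hlx, hlX] at e
    rw [ZMod.add_one_eq_of_ne h2 hA.ne] at e1
    -- With the quadratic `λ` terms gone, the condition for `n = 2` factors. The first factor gives
    -- `μ^g = μ^G` because `μ^g_{i,j}` and `μ^g_{i+1,j+1}` are inverse to each other; the second
    -- gives the condition on `γ`.
    have e2 : (1 - s.μG i j * s.μg (i + 1) i) * (2 * (γx * γX) - 1) = 0 := by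
      linear_combination e
    rcases mul_eq_zero.1 e2 with e3 | e3
    · left
      have h0 : s.μg (i + 1) i ≠ 0 := right_ne_zero_of_mul_eq_one e1
      exact mul_right_cancel₀ h0 (by linear_combination e1 + e3)
    · right
      rw [hζ.eq_neg_one_of_eq_two h2, inv_neg, inv_one]
      linear_combination e3

theorem TypeARestrictions.exists_action (hn : 2 ≤ n) (hζ : IsPrimitiveRoot ζ n) (hQ : Stable Q)
    (h : TypeARestrictions Q ζ γx γX s) :
    ∃ φ : HopfAction k (DTaft hζ) (PathAlgebra k Q),
      IsTypeAAction Q γx γX s φ ∧ PathAlgebra.Filtered φ := by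
  let w : Q → k := fun v => γx * rootPow ζ (label v)
  let w' : Q → k := fun v => γX * (rootPow ζ (label v))⁻¹
  have formulas : ∀ {g x G X : Module.End k (PathAlgebra k Q)},
      PathAlgebra.HasTaftValues (rotation Q) w w'
        (fun {u v} _ => s.μg (label u) (label v) • a k Q (label u + 1) (label v + 1))
        (fun {u v} _ => s.μG (label u) (label v) • a k Q (label u + 1) (label v + 1))
        (fun {u v} _ => s.lx (label u) (label v) • a k Q (label u) (label v + 1))
        (fun {u v} _ => s.lX (label u) (label v) • a k Q (label u) (label v + 1)) g x G X →
      OrbitFormulas (a k Q) (HasPath Q) ζ γx γx γX γX s g x G X := by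
    intro g x G X hv
    have d := fun i => h.μ_diag i
    have l := fun i => h.l_eq_zero i i (.inl rfl)
    refine ⟨fun i j hP => ?_, fun i j hP => ?_, fun i j hP => ?_, fun i j hP => ?_⟩ <;>
      rcases hP with rfl | hA
    · rw [(d i).1, one_smul, a_self, a_self]; exact hv.g_vertex _
    · rw [a_of_hasArrow hA]; exact hv.g_arrow _
    · rw [(d i).2, one_smul, a_self, a_self]; exact hv.G_vertex _
    · rw [a_of_hasArrow hA]; exact hv.G_arrow _
    · rw [(d i).1, mul_one, (l i).1, zero_smul, add_zero, a_self, a_self]; exact hv.x_vertex _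
    · rw [mul_smul (γx * rootPow ζ (i + 1)), a_of_hasArrow hA]; exact hv.x_arrow _
    · rw [(d i).2, mul_one, (l i).2, zero_smul, add_zero, a_self, a_self]; exact hv.X_vertex _
    · rw [mul_smul (γX * (rootPow ζ (i + 1))⁻¹), a_of_hasArrow hA]; exact hv.X_arrow _
  obtain ⟨φ, hφ, hfil⟩ := PathAlgebra.exists_hopfAction  hζ (rotation Q) w w' _ _ _ _
    (fun _ => (joins_a _ _).smul _) (fun _ => (joins_a _ _).smul _)
    (fun _ => (joins_a _ _).smul _) (fun _ => (joins_a _ _).smul _)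
    (fun hv z hz => by
      obtain ⟨i, j, hP, rfl⟩ := mem_generators hz
      exact (orbit_relations_iff hn hζ (isOrbitFamily hQ) (formulas hv)
        (fun i j hP => h.l_eq_zero i j (.inr hP))).2 (h.orbitConditions hζ) i j hP)
  refine ⟨φ, fun i j hP => ?_, hfil⟩
  have hf := formulas hφ
  refine ⟨hf.g i j hP, hf.G i j hP, ?_, ?_⟩
  · rw [hf.x i j hP]; module
  · rw [hf.X i j hP]; module

theorem IsTypeAAction.unique {φ ψ : HopfAction k (DTaft hζ) (PathAlgebra k Q)}
    (hφ : IsTypeAAction Q γx γX s φ) (hψ : IsTypeAAction Q γx γX s ψ) : ψ = φ := by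
  refine HopfAction.ext_of_adjoin_eq_top PathAlgebra.adjoin_generators fun i z hz => ?_
  obtain ⟨u, v, hP, rfl⟩ := mem_generators hz
  obtain ⟨h1, h2, h3, h4⟩ := hφ u v hP
  obtain ⟨h1', h2', h3', h4'⟩ := hψ u v hP
  cases i
  · exact h1'.trans h1.symm
  · exact h3'.trans h3.symm
  · exact h2'.trans h2.symm
  · exact h4'.trans h4.symm

theorem isVertexAction_iff {φ : HopfAction k (DTaft hζ) (PathAlgebra k (vertexQuiver n))} :
    IsVertexAction γx γX φ ↔ IsTypeAAction (vertexQuiver n) γx γX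
      ⟨fun _ _ => 1, fun _ _ => 1, fun _ _ => 0, fun _ _ => 0⟩ φ := by
  have hζ0 : ζ ≠ 0 := hζ.ne_zero (NeZero.ne n)
  have e1 := rootPow_add_one hζ.pow_eq_one
  constructor
  · intro h i j hP
    obtain rfl := hasPath_vertexQuiver.1 hP
    obtain ⟨h1, h2, h3, h4⟩ := h i
    simp only [a_self, e1, mul_inv]
    refine ⟨by rw [h1, one_smul], by rw [h2, one_smul], by rw [h3]; module, by rw [h4]; module⟩
  · intro h i
    obtain ⟨h1, h2, h3, h4⟩ := h i i (.inl rfl)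
    simp only [a_self, e1, mul_inv] at h1 h2 h3 h4
    refine ⟨by rw [h1, one_smul], by rw [h2, one_smul], by rw [h3]; module, by rw [h4]; module⟩

end TypeA

end PathAlgebraActions

/-! ### Type B: subquivers of the complete bipartite quiver -/

section TypeB

namespace BipartiteQuiver

open PathAlgebra

section Arrows

variable {n : ℕ} {Q : WideSubquiver (BipartiteQuiver n)}

variable (Q) in
/-- The rotation of the vertices. -/
def rotation : Equiv.Perm Q where
  toFun
    | top i => top (i + 1)
    | bot j => bot (j + 1)
  invFun
    | top i => top (i - 1)
    | bot j => bot (j - 1)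
  left_inv := by
    rintro (i | j)
    · exact congr_arg top (add_sub_cancel_right i 1)
    · exact congr_arg bot (add_sub_cancel_right j 1)
  right_inv := by
    rintro (i | j)
    · exact congr_arg top (sub_add_cancel i 1)
    · exact congr_arg bot (sub_add_cancel j 1)

/-- The label of a vertex. -/
def label : Q → ZMod n
  | top i => i
  | bot j => j

/-- The arrow from `i_+` to `j_-`. -/
def HasArrow.hom {i j : ZMod n} (h : HasArrow Q i j) :
    (show Q from top i) ⟶ (show Q from bot j) :=
  ⟨Arrow.b i j, h⟩

theorem arrow_cases {p : ∀ {u v : Q}, (u ⟶ v) → Prop}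
    (h : ∀ (i j : ZMod n) (hA : HasArrow Q i j), p hA.hom) {u v : Q} (α : u ⟶ v) : p α := by
  rcases α with ⟨⟨i, j⟩, hA⟩
  exact h i j hA

end Arrows

variable {k : Type*} [Field k] {n : ℕ} [NeZero n] {Q : WideSubquiver (BipartiteQuiver n)}

theorem b_of_hasArrow {i j : ZMod n} (h : HasArrow Q i j) : b k Q i j = arrow k h.hom := by
  rw [b, dif_pos h]
  rfl

theorem b_of_not_hasArrow {i j : ZMod n} (h : ¬ HasArrow Q i j) : b k Q i j = 0 := dif_neg h

theorem joins_b (i j : ZMod n) : Joins (V := Q) (top i) (bot j) (b k Q i j) := by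
  by_cases h : HasArrow Q i j
  · rw [b_of_hasArrow h]; exact joins_arrow _
  · rw [b_of_not_hasArrow h]; exact Joins.zero _ _

theorem isOrbitFamily_b (hQ : Stable Q) : IsOrbitFamily (b k Q) (HasArrow Q) k where
  stable := hQ
  zero _ _ := b_of_not_hasArrow
  dual i j hij := by
    classical
    obtain ⟨F, hv, ha⟩ := exists_matrix_representation k Q
    refine ⟨Matrix.entryLinearMap k k (m := Q) (n := Q) (top i) (bot j) ∘ₗ F.toLinearMap,
      fun i' j' => ?_⟩
    by_cases h : HasArrow Q i' j'
    · change F (b k Q i' j') (top i) (bot j) = _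
      rw [b_of_hasArrow h, ha]
      refine (Matrix.single_apply ..).trans (if_congr ?_ rfl rfl)
      exact and_congr ⟨fun h => top.inj h, congr_arg _⟩ ⟨fun h => bot.inj h, congr_arg _⟩
    · rw [b_of_not_hasArrow h, map_zero, if_neg]
      rintro ⟨rfl, rfl⟩
      exact h hij

/-- The trivial paths along an injective family of vertices form an orbit family. -/
theorem isOrbitFamily_vertex {f : ZMod n → Q} (hf : Function.Injective f) :
    IsOrbitFamily (fun i j => if i = j then vertex k (f i) else 0) (fun i j => i = j) k where
  stable _ _ := (add_left_inj 1).symm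
  zero _ _ h := if_neg h
  dual i j hij := by
    classical
    obtain rfl := hij
    obtain ⟨F, hv, ha⟩ := exists_matrix_representation k Q
    refine ⟨Matrix.entryLinearMap k k (m := Q) (n := Q) (f i) (f i) ∘ₗ F.toLinearMap,
      fun i' j' => ?_⟩
    by_cases h : i' = j'
    · subst h
      change F (if i' = i' then vertex k (f i') else 0) (f i) (f i) = _
      rw [if_pos rfl, hv]
      exact (Matrix.single_apply ..).trans (if_congr (and_congr hf.eq_iff hf.eq_iff) rfl rfl)
    · rw [if_neg h, map_zero, if_neg]
      rintro ⟨rfl, rfl⟩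
      exact h rfl

end BipartiteQuiver

open BipartiteQuiver

section Basic

variable {k : Type*} [Field k] {n : ℕ} {ζ : k} {Q : WideSubquiver (BipartiteQuiver n)}
  {γxp γxm γXp γXm : k} {s : ArrowScalars k n}

theorem top_injective : Function.Injective (top : ZMod n → BipartiteQuiver n) :=
  fun _ _ h => top.inj h

theorem bot_injective : Function.Injective (bot : ZMod n → BipartiteQuiver n) :=
  fun _ _ h => bot.inj h

theorem TypeBRestrictions.orbitConditions (h : TypeBRestrictions Q ζ γxp γxm γXp γXm s) :
    OrbitConditions (HasArrow Q) ζ γxp γxm γXp γXm s :=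
  ⟨h.compatible, h.x_pow, h.X_pow, fun h3 _ _ _ => h.γ_ge_three h3, h.l_comm, h.γ_two⟩

end Basic

section Vertices

variable {k : Type*} [Field k] {n : ℕ} [NeZero n] {Q : WideSubquiver (BipartiteQuiver n)}

/-- With trivial `μ`, zero `λ` and equal `γ` at source and target, the power conditions and the
condition for `n = 2` hold automatically. -/
theorem orbitConditions_eq_iff {ζ γ γ' : k} :
    OrbitConditions (fun i j : ZMod n => i = j) ζ γ γ γ' γ'
      ⟨fun _ _ => 1, fun _ _ => 1, fun _ _ => 0, fun _ _ => 0⟩ ↔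
      (3 ≤ n → γ * γ' * (1 - ζ⁻¹) = 1) := by
  refine ⟨fun h h3 => (h.γ_ge_three h3 0 0 rfl).1, fun h => ⟨fun i j _ => ?_, ?_, ?_,
    fun h3 _ _ _ => ⟨h h3, h h3⟩, by simp, by simp⟩⟩
  · constructor <;> simp
  · simp [NeZero.ne n]
  · simp [NeZero.ne n]

/-- One vertex orbit is treated as an orbit family supported on the diagonal, so the criterion for
arrows also applies to trivial paths. -/
theorem vertex_relations_iff (hn : 2 ≤ n) {ζ γ γ' : k} (hζ : IsPrimitiveRoot ζ n)
    {g x G X : Module.End k (PathAlgebra k Q)} {f : ZMod n → Q} (hf : Function.Injective f)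
    (h : ∀ i, g (PathAlgebra.vertex k (f i)) = PathAlgebra.vertex k (f (i + 1)) ∧
      G (PathAlgebra.vertex k (f i)) = PathAlgebra.vertex k (f (i + 1)) ∧
      x (PathAlgebra.vertex k (f i)) = (γ * rootPow ζ i) •
        (PathAlgebra.vertex k (f i) - ζ • PathAlgebra.vertex k (f (i + 1))) ∧
      X (PathAlgebra.vertex k (f i)) = (γ' * (rootPow ζ i)⁻¹) •
        (PathAlgebra.vertex k (f i) - ζ⁻¹ • PathAlgebra.vertex k (f (i + 1)))) :
    (∀ i, DRelationsAt n ζ g x G X (PathAlgebra.vertex k (f i))) ↔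
      (3 ≤ n → γ * γ' * (1 - ζ⁻¹) = 1) := by
  rw [← orbitConditions_eq_iff, ← orbit_relations_iff hn hζ
    (isOrbitFamily_vertex (k := k) hf) (g := g) (x := x) (G := G) (X := X) ?_ (by simp)]
  · constructor
    · rintro h i j rfl
      rw [if_pos rfl]
      exact h i
    · intro h i
      have := h i i rfl
      rwa [if_pos rfl] at this
  · have e1 := rootPow_add_one hζ.pow_eq_one
    constructor <;> rintro i j rfl <;> simp only [if_true]
    · rw [(h i).1, one_smul]
    · rw [(h i).2.1, one_smul]
    · rw [(h i).2.2.1, e1]; module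
    · rw [(h i).2.2.2, e1, mul_inv]; module

end Vertices

variable {k : Type*} [Field k] {n : ℕ} [NeZero n] {ζ : k} {hζ : IsPrimitiveRoot ζ n}
  {Q : WideSubquiver (BipartiteQuiver n)} {γxp γxm γXp γXm : k} {s : ArrowScalars k n}

theorem IsTypeBAction.orbitFormulas {φ : HopfAction k (DTaft hζ) (PathAlgebra k Q)}
    (h : IsTypeBAction Q γxp γxm γXp γXm s φ) :
    OrbitFormulas (b k Q) (HasArrow Q) ζ γxp γxm γXp γXm s (φ.act (DTaft.g hζ))
      (φ.act (DTaft.x hζ)) (φ.act (DTaft.G hζ)) (φ.act (DTaft.X hζ)) where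
  g i j hP := (h.2.2 i j hP).1
  G i j hP := (h.2.2 i j hP).2.1
  x i j hP := (h.2.2 i j hP).2.2.1
  X i j hP := (h.2.2 i j hP).2.2.2

/-- The conditions on `γ` for `n ≥ 3` are taken from the two vertex orbits, so they hold even if `Q`
has no arrows. All other conditions come from the arrows. -/
theorem IsTypeBAction.typeBRestrictions (hn : 2 ≤ n) (hQ : Stable Q)
    (hl : ∀ i j, ¬ HasArrow Q i (j + 1) → s.lx i j = 0 ∧ s.lX i j = 0)
    {φ : HopfAction k (DTaft hζ) (PathAlgebra k Q)} (h : IsTypeBAction Q γxp γxm γXp γXm s φ) :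
    TypeBRestrictions Q ζ γxp γxm γXp γXm s := by
  have hc : OrbitConditions (HasArrow Q) ζ γxp γxm γXp γXm s :=
    (orbit_relations_iff hn hζ (isOrbitFamily_b hQ) h.orbitFormulas hl).1
      fun i j _ => φ.dRelationsAt _
  have hp := (vertex_relations_iff (Q := Q) hn hζ top_injective h.1).1 fun i => φ.dRelationsAt _
  have hm := (vertex_relations_iff (Q := Q) hn hζ bot_injective h.2.1).1 fun i => φ.dRelationsAt _
  exact ⟨hc.compatible, hl, hc.x_pow, hc.X_pow, fun h3 => ⟨hp h3, hm h3⟩, hc.l_comm, hc.γ_two⟩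

theorem TypeBRestrictions.exists_action (hn : 2 ≤ n) (hζ : IsPrimitiveRoot ζ n) (hQ : Stable Q)
    (h : TypeBRestrictions Q ζ γxp γxm γXp γXm s) :
    ∃ φ : HopfAction k (DTaft hζ) (PathAlgebra k Q),
      IsTypeBAction Q γxp γxm γXp γXm s φ ∧ PathAlgebra.Filtered φ := by
  -- A weight on vertices makes `exists_hopfAction` put `γ_-` on the target term and `γ_+` on the
  -- rotated source term of each arrow.
  let w : Q → k
    | top i => γxp * rootPow ζ i
    | bot j => γxm * rootPow ζ j
  let w' : Q → k
    | top i => γXp * (rootPow ζ i)⁻¹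
    | bot j => γXm * (rootPow ζ j)⁻¹
  let f : ∀ {u v : Q}, (u ⟶ v) → PathAlgebra k Q := fun {u v} _ =>
    s.μg (label u) (label v) • b k Q (label u + 1) (label v + 1)
  let f' : ∀ {u v : Q}, (u ⟶ v) → PathAlgebra k Q := fun {u v} _ =>
    s.μG (label u) (label v) • b k Q (label u + 1) (label v + 1)
  let d : ∀ {u v : Q}, (u ⟶ v) → PathAlgebra k Q := fun {u v} _ =>
    s.lx (label u) (label v) • b k Q (label u) (label v + 1)
  let d' : ∀ {u v : Q}, (u ⟶ v) → PathAlgebra k Q := fun {u v} _ =>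
    s.lX (label u) (label v) • b k Q (label u) (label v + 1)
  have e1 := rootPow_add_one hζ.pow_eq_one
  have plus : ∀ {g x G X : Module.End k (PathAlgebra k Q)},
      PathAlgebra.HasTaftValues (rotation Q) w w' f f' d d' g x G X → ∀ i : ZMod n,
        g (ePlus k Q i) = ePlus k Q (i + 1) ∧ G (ePlus k Q i) = ePlus k Q (i + 1) ∧
        x (ePlus k Q i) = (γxp * rootPow ζ i) • (ePlus k Q i - ζ • ePlus k Q (i + 1)) ∧
        X (ePlus k Q i) = (γXp * (rootPow ζ i)⁻¹) • (ePlus k Q i - ζ⁻¹ • ePlus k Q (i + 1)) := by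
    intro g x G X hv i
    refine ⟨hv.g_vertex (top i), hv.G_vertex (top i), (hv.x_vertex (top i)).trans ?_,
      (hv.X_vertex (top i)).trans ?_⟩
    · change (γxp * rootPow ζ i) • ePlus k Q i
        - (γxp * rootPow ζ (i + 1)) • ePlus k Q (i + 1) = _
      rw [e1]; module
    · change (γXp * (rootPow ζ i)⁻¹) • ePlus k Q i
        - (γXp * (rootPow ζ (i + 1))⁻¹) • ePlus k Q (i + 1) = _
      rw [e1, mul_inv]; module
  have minus : ∀ {g x G X : Module.End k (PathAlgebra k Q)},
      PathAlgebra.HasTaftValues (rotation Q) w w' f f' d d' g x G X → ∀ j : ZMod n,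
        g (eMinus k Q j) = eMinus k Q (j + 1) ∧ G (eMinus k Q j) = eMinus k Q (j + 1) ∧
        x (eMinus k Q j) = (γxm * rootPow ζ j) • (eMinus k Q j - ζ • eMinus k Q (j + 1)) ∧
        X (eMinus k Q j) =
          (γXm * (rootPow ζ j)⁻¹) • (eMinus k Q j - ζ⁻¹ • eMinus k Q (j + 1)) := by
    intro g x G X hv j
    refine ⟨hv.g_vertex (bot j), hv.G_vertex (bot j), (hv.x_vertex (bot j)).trans ?_,
      (hv.X_vertex (bot j)).trans ?_⟩
    · change (γxm * rootPow ζ j) • eMinus k Q j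
        - (γxm * rootPow ζ (j + 1)) • eMinus k Q (j + 1) = _
      rw [e1]; module
    · change (γXm * (rootPow ζ j)⁻¹) • eMinus k Q j
        - (γXm * (rootPow ζ (j + 1))⁻¹) • eMinus k Q (j + 1) = _
      rw [e1, mul_inv]; module
  have arrows : ∀ {g x G X : Module.End k (PathAlgebra k Q)},
      PathAlgebra.HasTaftValues (rotation Q) w w' f f' d d' g x G X →
        OrbitFormulas (b k Q) (HasArrow Q) ζ γxp γxm γXp γXm s g x G X := by
    intro g x G X hv
    refine ⟨fun i j hA => ?_, fun i j hA => ?_, fun i j hA => ?_, fun i j hA => ?_⟩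
    · rw [b_of_hasArrow hA]; exact hv.g_arrow _
    · rw [b_of_hasArrow hA]; exact hv.G_arrow _
    · rw [mul_smul (γxp * rootPow ζ (i + 1)), b_of_hasArrow hA]; exact hv.x_arrow _
    · rw [mul_smul (γXp * (rootPow ζ (i + 1))⁻¹), b_of_hasArrow hA]; exact hv.X_arrow _
  obtain ⟨φ, hφ, hfil⟩ := PathAlgebra.exists_hopfAction hζ (rotation Q) w w' f f' d d'
    (fun α => by induction α using arrow_cases with | h i j _ => exact (joins_b _ _).smul _)
    (fun α => by induction α using arrow_cases with | h i j _ => exact (joins_b _ _).smul _)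
    (fun α => by induction α using arrow_cases with | h i j _ => exact (joins_b _ _).smul _)
    (fun α => by induction α using arrow_cases with | h i j _ => exact (joins_b _ _).smul _)
    (fun hv z hz => by
      rcases hz with ⟨i | j, rfl⟩ | ⟨u, v, α, rfl⟩
      · exact (vertex_relations_iff (Q := Q) hn hζ top_injective (plus hv)).2
          (fun h3 => (h.γ_ge_three h3).1) i
      · exact (vertex_relations_iff (Q := Q) hn hζ bot_injective (minus hv)).2
          (fun h3 => (h.γ_ge_three h3).2) j
      · induction α using arrow_cases with
        | h i j hA =>
        rw [← b_of_hasArrow hA]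
        exact (orbit_relations_iff hn hζ (isOrbitFamily_b hQ) (arrows hv) h.l_eq_zero).2
          h.orbitConditions i j hA)
  have ha := arrows hφ
  exact ⟨φ, ⟨plus hφ, minus hφ, fun i j hA => ⟨ha.g i j hA, ha.G i j hA, ha.x i j hA,
    ha.X i j hA⟩⟩, hfil⟩

theorem IsTypeBAction.unique {φ ψ : HopfAction k (DTaft hζ) (PathAlgebra k Q)}
    (hφ : IsTypeBAction Q γxp γxm γXp γXm s φ) (hψ : IsTypeBAction Q γxp γxm γXp γXm s ψ) :
    ψ = φ := by
  refine HopfAction.ext_of_adjoin_eq_top PathAlgebra.adjoin_generators fun i z hz => ?_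
  rcases hz with ⟨v, rfl⟩ | ⟨u, v, α, rfl⟩
  · rcases v with l | l
    · obtain ⟨h1, h2, h3, h4⟩ := hφ.1 l
      obtain ⟨h1', h2', h3', h4'⟩ := hψ.1 l
      cases i
      · exact h1'.trans h1.symm
      · exact h3'.trans h3.symm
      · exact h2'.trans h2.symm
      · exact h4'.trans h4.symm
    · obtain ⟨h1, h2, h3, h4⟩ := hφ.2.1 l
      obtain ⟨h1', h2', h3', h4'⟩ := hψ.2.1 l
      cases i
      · exact h1'.trans h1.symm
      · exact h3'.trans h3.symm
      · exact h2'.trans h2.symm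
      · exact h4'.trans h4.symm
  · induction α using arrow_cases with
    | h l m hA =>
    rw [← b_of_hasArrow hA]
    obtain ⟨h1, h2, h3, h4⟩ := hφ.2.2 l m hA
    obtain ⟨h1', h2', h3', h4'⟩ := hψ.2.2 l m hA
    cases i
    · exact h1'.trans h1.symm
    · exact h3'.trans h3.symm
    · exact h2'.trans h2.symm
    · exact h4'.trans h4.symm

end TypeB
-- The classification
theorem mainTheorem9 {k : Type*} [Field k] (n : ℕ) [NeZero n] (hn : 2 ≤ n) (ζ : k)
    (hζ : IsPrimitiveRoot ζ n) :
    -- a single orbit of vertices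
    (∀ γx γX : k,
      ((3 ≤ n → γx * γX * (1 - ζ⁻¹) = 1) →
        ∃ φ : HopfAction k (DTaft hζ) (PathAlgebra k (vertexQuiver n)),
          IsVertexAction γx γX φ ∧ ∀ ψ, IsVertexAction γx γX ψ → ψ = φ) ∧
      ((∃ φ : HopfAction k (DTaft hζ) (PathAlgebra k (vertexQuiver n)),
          IsVertexAction γx γX φ) → 3 ≤ n → γx * γX * (1 - ζ⁻¹) = 1)) ∧
    -- Type A
    (∀ Q : WideSubquiver (CompleteQuiver n), CompleteQuiver.Stable Q →
      ∀ (γx γX : k) (s : ArrowScalars k n),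
      (TypeARestrictions Q ζ γx γX s →
        ∃ φ : HopfAction k (DTaft hζ) (PathAlgebra k Q),
          IsTypeAAction Q γx γX s φ ∧ PathAlgebra.Filtered φ ∧
            ∀ ψ, IsTypeAAction Q γx γX s ψ → ψ = φ) ∧
      ((∀ i j, ¬ CompleteQuiver.HasPath Q i (j + 1) → s.lx i j = 0 ∧ s.lX i j = 0) →
        (∃ φ : HopfAction k (DTaft hζ) (PathAlgebra k Q), IsTypeAAction Q γx γX s φ) →
          TypeARestrictions Q ζ γx γX s)) ∧
    -- Type B
    (∀ Q : WideSubquiver (BipartiteQuiver n), BipartiteQuiver.Stable Q →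
      ∀ (γxp γxm γXp γXm : k) (s : ArrowScalars k n),
      (TypeBRestrictions Q ζ γxp γxm γXp γXm s →
        ∃ φ : HopfAction k (DTaft hζ) (PathAlgebra k Q),
          IsTypeBAction Q γxp γxm γXp γXm s φ ∧ PathAlgebra.Filtered φ ∧
            ∀ ψ, IsTypeBAction Q γxp γxm γXp γXm s ψ → ψ = φ) ∧
      ((∀ i j, ¬ BipartiteQuiver.HasArrow Q i (j + 1) → s.lx i j = 0 ∧ s.lX i j = 0) →
        (∃ φ : HopfAction k (DTaft hζ) (PathAlgebra k Q),
          IsTypeBAction Q γxp γxm γXp γXm s φ) →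
            TypeBRestrictions Q ζ γxp γxm γXp γXm s)) := by
  refine ⟨fun γx γX => ⟨fun h => ?_, fun ⟨φ, hφ⟩ => ?_⟩, fun Q hQ γx γX s => ⟨fun h => ?_,
    fun hl ⟨φ, hφ⟩ => hφ.typeARestrictions hn hQ hl⟩, fun Q hQ γxp γxm γXp γXm s => ⟨fun h => ?_,
    fun hl ⟨φ, hφ⟩ => hφ.typeBRestrictions hn hQ hl⟩⟩
  -- The vertex case is Type A for the quiver without arrows.
  · obtain ⟨φ, hφ, -⟩ := (typeARestrictions_vertexQuiver_iff.2 h).exists_action hn hζ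
      stable_vertexQuiver
    exact ⟨φ, isVertexAction_iff.2 hφ, fun ψ hψ => hφ.unique (isVertexAction_iff.1 hψ)⟩
  · exact typeARestrictions_vertexQuiver_iff.1
      ((isVertexAction_iff.1 hφ).typeARestrictions hn stable_vertexQuiver (by simp))
  · obtain ⟨φ, hφ, hf⟩ := h.exists_action hn hζ hQ
    exact ⟨φ, hφ, hf, fun ψ hψ => hφ.unique hψ⟩
  · obtain ⟨φ, hφ, hf⟩ := h.exists_action hn hζ hQ
    exact ⟨φ, hφ, hf, fun ψ hψ => hφ.unique hψ⟩
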